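/- \textbf{The game.} Let $G=(V,E)$ be a finite connected simple graph with at least two vertices and $\emptyset\neq W\subseteq V$. A \emph{hunter strategy} is a finite sequence $\mathcal S=(S_1,\dots,S_\ell)$ of non-empty subsets of $V$; it \emph{uses} $\max_i|S_i|$ hunters. It is \emph{winning with respect to $W$} if for every walk $(r_0,\dots,r_\ell)$ in $G$ with $r_0\in W$ there is $0\le j<\ell$ with $r_j\in S_{j+1}$. Put $Z_0=W$ and $Z_i=\{x\in V : xy\in E \text{ for some } y\in Z_{i-1}\setminus S_i\}$ for $1\le i\le \ell$. A vertex $v$ is \emph{cleared at round $i$} if $v\in S_i$, or $\emptyset\ne N(v)\cap Z_{i-1}\subseteq S_i$. A winning strategy is \emph{monotone} if, whenever $v$ is cleared at round $i$ and $v\in Z_j$ for some $j>i$, then $v\in S_{j+1}$. Let $h_W(G)$ (resp. $mh_W(G)$) be the least number of hunters used by a winning (resp. monotone winning) strategy with respect to $W$, and let $h(G)=h_V(G)$. \textbf{The trees.} For $q\ge 6$, let $T_{1,q}$ be the spider formed by $q$ paths with $3$ edges sharing one endpoint, the root, and let $\ell_1=4q$. For $i\ge2$, put $p_i^1=2$ and,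 for $1<j\le q$, let $p_i^j$ be the least even integer that is at least $\ell_{i-1}+\sum_{1\le k<j}p_i^k$. The tree $T_{i,q}$ consists of a new vertex, its root, and $q$ disjoint copies of $T_{i-1,q}$, the root of the $j$-th copy being linked to the new root by a path with $p_i^j$ edges. Let $\ell_i$ be the least even integer that is at least $q\,\ell_{i-1}+\sum_{1\le j\le q}j\,p_i^j$. Let $V_r$ be the class of the bipartition of $T_{i,q}$ that contains the root, i.e. the set of vertices at even distance from the root. \textbf{Theorem.} For every $i\ge3$ the tree $T=T_{2i,2i}$ satisfies $$h_{V_r}(T)=h(T)=2\qquad\text{and}\qquad mh_{V_r}(T)\ge i .$$ In particular, for every $m\in\mathbb N$ there is a finite tree $T$ with a bipartition $(V_r,V_w)$ such that $mh_{V_r}(T)\ge h(T)+m$. -/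

import Mathlib

namespace HuntersRabbit

/-- A hunter strategy `(S_1, …, S_ℓ)` : a finite sequence of non-empty finite sets of vertices.
Here `shot i` is `S_i` for `1 ≤ i ≤ length`; the values of `shot` outside this range play no role
in any notion below. -/
structure HunterStrategy (V : Type*) where
  length : ℕ
  shot : ℕ → Finset V
  nonempty : ∀ i, 1 ≤ i → i ≤ length → (shot i).Nonempty

/-- The number of hunters used by a strategy: the maximum of `|S_i|`, `1 ≤ i ≤ ℓ`. -/
def HunterStrategy.hunters {V : Type*} (S : HunterStrategy V) : ℕ :=
  (Finset.Icc 1 S.length).sup fun i => (S.shot i).card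

/-- `S` is winning with respect to `W`: every rabbit trajectory `(r_0, …, r_ℓ)` starting in `W`
satisfies `r_j ∈ S_{j+1}` for some `0 ≤ j < ℓ`. -/
def Winning {V : Type*} (G : SimpleGraph V) (W : Set V) (S : HunterStrategy V) : Prop :=
  ∀ r : ℕ → V, r 0 ∈ W → (∀ i < S.length, G.Adj (r i) (r (i + 1))) →
    ∃ j < S.length, r j ∈ S.shot (j + 1)

/-- The set `Z_i` of contaminated vertices after round `i` (meaningful for `i ≤ ℓ`). -/
def contaminated {V : Type*} (G : SimpleGraph V) (W : Set V) (S : HunterStrategy V) : ℕ → Set V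
  | 0 => W
  | i + 1 => {x | ∃ y ∈ contaminated G W S i, y ∉ S.shot (i + 1) ∧ G.Adj x y}

/-- `v` is cleared at round `i ≥ 1`: either it is shot, or it has contaminated neighbours and all
of them are shot. -/
def Cleared {V : Type*} (G : SimpleGraph V) (W : Set V) (S : HunterStrategy V) (v : V) (i : ℕ) :
    Prop :=
  v ∈ S.shot i ∨
    ((G.neighborSet v ∩ contaminated G W S (i - 1)).Nonempty ∧
      G.neighborSet v ∩ contaminated G W S (i - 1) ⊆ (S.shot i : Set V))

/-- Monotonicity of a strategy: once `v` has been cleared at round `i`, whenever `v ∈ Z_j` at a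
later time `j > i`, it is shot at once, `v ∈ S_{j+1}`. (`Z_ℓ` is empty for winning strategies.) -/
def MonotoneStrategy {V : Type*} (G : SimpleGraph V) (W : Set V) (S : HunterStrategy V) : Prop :=
  ∀ (v : V) (i j : ℕ), 1 ≤ i → i < j → j < S.length → Cleared G W S v i →
    v ∈ contaminated G W S j → v ∈ S.shot (j + 1)

open Classical in
/-- The hunter number `h_W(G)` (`0` by convention for a one-vertex graph). -/
noncomputable def hunterNumberWrt {V : Type*} (G : SimpleGraph V) (W : Set V) : ℕ :=
  if Subsingleton V then 0
  else sInf {k | ∃ S : HunterStrategy V, Winning G W S ∧ S.hunters = k}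

/-- The hunter number `h(G) = h_V(G)`. -/
noncomputable def hunterNumber {V : Type*} (G : SimpleGraph V) : ℕ :=
  hunterNumberWrt G Set.univ

open Classical in
/-- The monotone hunter number `mh_W(G)` (`0` by convention for a one-vertex graph). -/
noncomputable def monotoneHunterNumberWrt {V : Type*} (G : SimpleGraph V) (W : Set V) : ℕ :=
  if Subsingleton V then 0
  else sInf {k | ∃ S : HunterStrategy V,
    Winning G W S ∧ MonotoneStrategy G W S ∧ S.hunters = k}

/-- `(Vr, Vw)` is a bipartition of the vertex set of `G` into two independent sets. -/
def IsBipartition {V : Type*} (G : SimpleGraph V) (Vr Vw : Set V) : Prop :=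
  IsCompl Vr Vw ∧ G.IsIndepSet Vr ∧ G.IsIndepSet Vw

structure RootedGraph where
  V : Type
  graph : SimpleGraph V
  root : V

/-- Vertices of the graph obtained from a new vertex `center` and `q` disjoint copies of a rooted
graph on `V`, the root of the `j`-th copy being linked to `center` by a path with `p j` edges,
that is, with `p j - 1` inner vertices. -/
inductive JoinVertex (q : ℕ) (p : Fin q → ℕ) (V : Type) : Type
  | center : JoinVertex q p V
  | inner (j : Fin q) (t : Fin (p j - 1)) : JoinVertex q p V
  | copy (j : Fin q) (v : V) : JoinVertex q p V

/-- The vertex at position `t`, `0 ≤ t ≤ p j`, of the `j`-th path: position `0` is the center,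
position `p j` is the root of the `j`-th copy. -/
def pathVertex (R : RootedGraph) {q : ℕ} (p : Fin q → ℕ) (j : Fin q) (t : ℕ) :
    JoinVertex q p R.V :=
  if t = 0 then .center
  else if h : t - 1 < p j - 1 then .inner j ⟨t - 1, h⟩
  else .copy j R.root

/-- `q` copies of `R`, whose roots are linked to a new root by paths of lengths
`p 0, …, p (q - 1)` (all lengths positive). -/
def join (R : RootedGraph) {q : ℕ} (p : Fin q → ℕ) : RootedGraph where
  V := JoinVertex q p R.V
  graph := SimpleGraph.fromRel fun x y =>
    (∃ j, ∃ t < p j, x = pathVertex R p j t ∧ y = pathVertex R p j (t + 1)) ∨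
    (∃ j u v, R.graph.Adj u v ∧ x = .copy j u ∧ y = .copy j v)
  root := .center

/-- The one-vertex rooted graph. -/
def point : RootedGraph where
  V := Unit
  graph := ⊥
  root := ()

/-- The spider `S_{k,q}`: `q` paths with `k` edges sharing one endpoint, the root. -/
def spider (k q : ℕ) : RootedGraph := join point fun _ : Fin q => k

/-- The smallest even integer `≥ n`. -/
def evenCeil (n : ℕ) : ℕ := n + n % 2

/-- With `ℓ = ℓ_{i-1}`, `linkLength ℓ j` is the length `p_i^{j+1}` of the path to the copy
number `j + 1`:
`p_i^1 = 2`, and `p_i^j` is the least even integer `≥ ℓ_{i-1} + ∑_{1 ≤ k < j} p_i^k`. -/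
def linkLength (l : ℕ) : ℕ → ℕ
  | 0 => 2
  | j + 1 => evenCeil (l + ∑ k : Fin (j + 1), linkLength l k)

/-- The numbers `ℓ_i`: `ℓ_1 = 4 q`, and `ℓ_i` is the least even integer
`≥ q ℓ_{i-1} + ∑_{1 ≤ j ≤ q} j p_i^j`. (The value at index `0` is not used.) -/
def roundBound (q : ℕ) : ℕ → ℕ
  | 0 => 0
  | 1 => 4 * q
  | i + 2 => evenCeil (q * roundBound q (i + 1) +
      ∑ j : Fin q, ((j : ℕ) + 1) * linkLength (roundBound q (i + 1)) j)

/-- The rooted tree `T_{i,q}`: `T_{1,q} = S_{3,q}`, and `T_{i,q}` is obtained from `q` copies of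
`T_{i-1,q}` by linking their roots to a new root by paths of lengths `p_i^1, …, p_i^q`.
(The value at index `0` is not used.) -/
def gapTree (q : ℕ) : ℕ → RootedGraph
  | 0 => point
  | 1 => spider 3 q
  | i + 2 => join (gapTree q (i + 1)) fun j : Fin q => linkLength (roundBound q (i + 1)) j

/-- The red class of a rooted (connected, bipartite) graph: the class containing the root, i.e.
the vertices at even distance from the root. -/
def RootedGraph.red (R : RootedGraph) : Set R.V := {v | Even (R.graph.dist R.root v)}

end HuntersRabbit

/-! Two hunters suffice because of a statement strong enough for induction, `ExposedClearable`: they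
can clear a tree, its root excepted, even if the root is recontaminated from outside at every even
time. In a join, branches are cleared from the last to the first. While the hunters play in copy
`j`, contamination leaks through the center into the branches cleared earlier. The link lengths grow
so fast that it has not entered their copies when one hunter guards the center and the other sweeps
the links in increasing order (`exposedClearable_join`). A final shot at the root makes the length
odd, so playing the strategy twice catches a rabbit of either parity. One hunter never suffices,
because the tree contains a spider with three legs of three edges (`IsSpider.two_le_hunters`).

For the monotone bound, the survivors of two consecutive rounds of a monotone winning strategy form
a decreasing sequence of sets, a clearing, whose outer boundary has at most twice as many vertices
as there are hunters (`BoundaryAtLeast.le_two_mul_hunters`). The classical three-branches argument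
for pathwidth adds one boundary vertex at each join (`BoundaryAtLeast.join`). So `2 * i` levels
force `2 * i` boundary vertices, hence `i` hunters. -/

namespace HuntersRabbit

/-! ### Depth functions, trees and bipartitions. -/

/-- A depth function on a rooted graph: depths of adjacent vertices differ by one, and every vertex
other than the root has exactly one neighbour closer to the root. -/
structure IsLayering (R : RootedGraph) (d : R.V → ℕ) : Prop where
  zero_iff : ∀ v, d v = 0 ↔ v = R.root
  adj : ∀ {u v}, R.graph.Adj u v → d v = d u + 1 ∨ d u = d v + 1
  parent : ∀ v, v ≠ R.root → ∃ u, R.graph.Adj v u ∧ d v = d u + 1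
  unique : ∀ {u v w}, R.graph.Adj v u → R.graph.Adj v w → d v = d u + 1 → d v = d w + 1 → u = w

namespace IsLayering

variable {R : RootedGraph} {d : R.V → ℕ}

theorem depth_root (h : IsLayering R d) : d R.root = 0 := (h.zero_iff _).2 rfl

theorem reachable (h : IsLayering R d) (v : R.V) : R.graph.Reachable R.root v := by
  induction hn : d v generalizing v with
  | zero => rw [(h.zero_iff v).1 hn]
  | succ n ih =>
    obtain ⟨u, hu, hd⟩ := h.parent v (fun hv => by rw [(h.zero_iff v).2 hv] at hn; omega)
    exact (ih u (by omega)).trans hu.symm.reachable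

theorem connected (h : IsLayering R d) : R.graph.Connected :=
  SimpleGraph.connected_iff_exists_forall_reachable _ |>.2 ⟨R.root, h.reachable⟩

/-- Every edge joins a vertex to its parent, so sending a non-root vertex to its parent edge is
surjective. A connected graph with at most `|V| - 1` edges is a tree. -/
theorem isTree [Finite R.V] (h : IsLayering R d) : R.graph.IsTree := by
  classical
  have := Fintype.ofFinite R.V
  rw [SimpleGraph.isTree_iff_connected_and_card]
  refine ⟨h.connected, le_antisymm ?_ h.connected.card_vert_le_card_edgeSet_add_one⟩
  choose f hf using h.parent
  let g : {v : R.V // v ≠ R.root} → R.graph.edgeSet := fun v => ⟨s(v, f v v.2), (hf v v.2).1⟩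
  have key : ∀ {u v}, R.graph.Adj u v → d v = d u + 1 → ∃ (hv : v ≠ R.root), f v hv = u := by
    intro u v huv hd
    have hv : v ≠ R.root := fun e => by rw [(h.zero_iff v).2 e] at hd; omega
    exact ⟨hv, h.unique (hf v hv).1 huv.symm (hf v hv).2 hd⟩
  have hg : Function.Surjective g := by
    rintro ⟨e, he⟩
    induction e with
    | _ u v =>
      rcases h.adj he with hd | hd
      · obtain ⟨hv, e⟩ := key he hd
        exact ⟨⟨v, hv⟩, Subtype.ext (by simp only [g, e]; exact Sym2.eq_swap)⟩
      · obtain ⟨hv, e⟩ := key (SimpleGraph.Adj.symm he) hd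
        exact ⟨⟨u, hv⟩, Subtype.ext (by simp only [g, e])⟩
  have h1 := Nat.card_le_card_of_surjective g hg
  have h2 : Nat.card {v : R.V // v ≠ R.root} = Nat.card R.V - 1 := by
    rw [Nat.card_eq_fintype_card, Nat.card_eq_fintype_card, Fintype.card_subtype_compl]
    simp
  have h3 : 0 < Nat.card R.V := by
    have : Nonempty R.V := ⟨R.root⟩
    exact Nat.card_pos
  omega

theorem even_dist_iff (h : IsLayering R d) (v : R.V) :
    Even (R.graph.dist R.root v) ↔ Even (d v) := by
  obtain ⟨w, hw⟩ := (h.reachable v).exists_walk_length_eq_dist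
  rw [← hw]
  have : ∀ {a b} (w : R.graph.Walk a b), Even w.length ↔ (Even (d a) ↔ Even (d b)) := by
    intro a b w
    induction w with
    | nil => simp
    | cons hab w ih =>
      rw [SimpleGraph.Walk.length_cons, Nat.even_add_one, ih]
      rcases h.adj hab with e | e <;> (rw [e, Nat.even_add_one]; tauto)
  rw [this w, h.depth_root]
  simp

theorem red_eq (h : IsLayering R d) : R.red = {v | Even (d v)} :=
  Set.ext fun v => h.even_dist_iff v

theorem even_iff_of_adj (h : IsLayering R d) {u v : R.V} (huv : R.graph.Adj u v) :
    Even (d u) ↔ ¬ Even (d v) := by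
  rcases h.adj huv with e | e <;> simp [e, Nat.even_add_one]

theorem isBipartition (h : IsLayering R d) : IsBipartition R.graph R.red R.redᶜ := by
  refine ⟨isCompl_compl, ?_, ?_⟩ <;> rw [h.red_eq]
  · intro u hu v hv _ huv
    exact (h.even_iff_of_adj huv).1 hu hv
  · intro u hu v hv _ huv
    exact hu ((h.even_iff_of_adj huv).2 hv)

end IsLayering

/-! ### Edges and depths in a join. -/

section Join

variable {R : RootedGraph} {q : ℕ} {p : Fin q → ℕ} {d : R.V → ℕ}

instance [Finite R.V] : Finite (JoinVertex q p R.V) := by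
  let f : JoinVertex q p R.V → Option ((Σ j : Fin q, Fin (p j - 1)) ⊕ (Fin q × R.V))
    | .center => none
    | .inner j t => some (.inl ⟨j, t⟩)
    | .copy j v => some (.inr (j, v))
  refine Finite.of_injective f ?_
  rintro (_ | ⟨j, t⟩ | ⟨j, v⟩) (_ | ⟨k, s⟩ | ⟨k, w⟩) h <;> simp_all [f]

/-- The branch of a vertex of a join, `none` at the center. -/
def arm : JoinVertex q p R.V → Option (Fin q)
  | .center => none
  | .inner j _ => some j
  | .copy j _ => some j

/-- The depth function of a join. -/
def joinDepth (d : R.V → ℕ) : JoinVertex q p R.V → ℕ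
  | .center => 0
  | .inner _ t => t + 1
  | .copy j v => p j + d v

theorem arm_pathVertex (j : Fin q) {t : ℕ} (ht : t ≠ 0) : arm (pathVertex R p j t) = some j := by
  unfold pathVertex
  rw [if_neg ht]
  split_ifs <;> rfl

theorem pathVertex_zero (j : Fin q) : pathVertex R p j 0 = .center := by simp [pathVertex]

theorem pathVertex_root (j : Fin q) (hp : 0 < p j) :
    pathVertex R p j (p j) = .copy j R.root := by
  simp [pathVertex, hp.ne']

theorem pathVertex_ne_copy {j k : Fin q} {t : ℕ} (ht : t < p j) (v : R.V) :
    pathVertex R p j t ≠ .copy k v := by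
  unfold pathVertex
  split_ifs
  · simp
  · simp
  · omega

theorem pathVertex_succ_eq_copy {j k : Fin q} {t : ℕ} {v : R.V}
    (h : pathVertex R p j (t + 1) = .copy k v) : j = k ∧ v = R.root := by
  unfold pathVertex at h
  split_ifs at h <;> simp_all

theorem joinDepth_pathVertex (h0 : d R.root = 0) (j : Fin q) {t : ℕ} (ht : t ≤ p j) :
    joinDepth d (pathVertex R p j t) = t := by
  unfold pathVertex
  split_ifs <;> simp [joinDepth] <;> omega

theorem eq_pathVertex (h : IsLayering R d) {j : Fin q} (hp : 0 < p j) {x : JoinVertex q p R.V}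
    (hx : arm x = some j) (hd : joinDepth d x ≤ p j) : x = pathVertex R p j (joinDepth d x) := by
  cases x with
  | center => simp [arm] at hx
  | inner k t =>
    obtain rfl : k = j := by simpa [arm] using hx
    simp [pathVertex, joinDepth]
  | copy k v =>
    obtain rfl : k = j := by simpa [arm] using hx
    have hv : d v = 0 := by simp only [joinDepth] at hd; omega
    simp only [joinDepth, hv, add_zero]
    rw [pathVertex_root k hp, (h.zero_iff v).1 hv]

theorem join_adj_pathVertex (h : IsLayering R d) (j : Fin q) {t : ℕ} (ht : t < p j) :
    (join R p).graph.Adj (pathVertex R p j t) (pathVertex R p j (t + 1)) := by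
  refine (SimpleGraph.fromRel_adj _ _ _).2 ⟨fun e => ?_, .inl (.inl ⟨j, t, ht, rfl, rfl⟩)⟩
  have := congrArg (joinDepth d) e
  rw [joinDepth_pathVertex h.depth_root j ht.le, joinDepth_pathVertex h.depth_root j ht] at this
  omega

theorem join_adj_cases {x y : JoinVertex q p R.V} (hxy : (join R p).graph.Adj x y) :
    (∃ j, ∃ t < p j, x = pathVertex R p j t ∧ y = pathVertex R p j (t + 1)) ∨
    (∃ j, ∃ t < p j, y = pathVertex R p j t ∧ x = pathVertex R p j (t + 1)) ∨
    (∃ j u v, R.graph.Adj u v ∧ x = .copy j u ∧ y = .copy j v) := by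
  rcases ((SimpleGraph.fromRel_adj _ _ _).1 hxy).2 with (h | h) | (h | ⟨j, u, v, huv, rfl, rfl⟩)
  · exact .inl h
  · exact .inr (.inr h)
  · exact .inr (.inl h)
  · exact .inr (.inr ⟨j, v, u, huv.symm, rfl, rfl⟩)

theorem join_adj_copy {j : Fin q} {u v : R.V} (huv : R.graph.Adj u v) :
    (join R p).graph.Adj (.copy j u : JoinVertex q p R.V) (.copy j v : JoinVertex q p R.V) := by
  refine (SimpleGraph.fromRel_adj _ _ _).2 ⟨fun e => huv.ne ?_, .inl (.inr ⟨j, u, v, huv, rfl, rfl⟩)⟩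
  exact (JoinVertex.copy.inj e).2

/-- The neighbours of a vertex of a copy: the neighbours in the copy and, for the root of the copy,
a vertex outside of the copy. -/
theorem adj_of_join_adj_copy {j : Fin q} {v : R.V} {y : JoinVertex q p R.V}
    (h : (join R p).graph.Adj (.copy j v : JoinVertex q p R.V) y) :
    v = R.root ∨ ∃ u, y = .copy j u ∧ R.graph.Adj v u := by
  rcases join_adj_cases h with ⟨k, t, ht, e, -⟩ | ⟨k, t, -, -, e⟩ | ⟨k, a, b, hab, e, rfl⟩
  · exact absurd e.symm (pathVertex_ne_copy ht v)
  · exact .inl (pathVertex_succ_eq_copy e.symm).2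
  · obtain ⟨rfl, rfl⟩ : j = k ∧ v = a := by simpa using e
    exact .inr ⟨b, rfl, hab⟩

theorem join_adj_arm {x y : JoinVertex q p R.V} (h : (join R p).graph.Adj x y) {j : Fin q}
    (hx : arm x = some j) : y = .center ∨ arm y = some j := by
  rcases join_adj_cases h with ⟨k, t, ht, rfl, rfl⟩ | ⟨k, t, ht, rfl, rfl⟩ | ⟨k, a, b, -, rfl, rfl⟩
  · rcases eq_or_ne t 0 with rfl | h0
    · simp [pathVertex_zero, arm] at hx
    · rw [arm_pathVertex k h0] at hx
      exact .inr (by rw [arm_pathVertex k (by omega), hx])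
  · rcases eq_or_ne t 0 with rfl | h0
    · exact .inl (pathVertex_zero k)
    · rw [arm_pathVertex k (by omega)] at hx
      exact .inr (by rw [arm_pathVertex k h0, hx])
  · exact .inr hx

theorem IsLayering.join (h : IsLayering R d) (hp : ∀ j, 0 < p j) :
    IsLayering (join R p) (joinDepth (q := q) (p := p) d) := by
  have down : ∀ {u v : JoinVertex q p R.V}, (HuntersRabbit.join R p).graph.Adj v u →
      joinDepth d v = joinDepth d u + 1 →
      (∃ j, ∃ t < p j, u = pathVertex R p j t ∧ v = pathVertex R p j (t + 1)) ∨
      (∃ j a b, R.graph.Adj a b ∧ d a = d b + 1 ∧ v = .copy j a ∧ u = .copy j b) := by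
    intro u v huv hd
    rcases join_adj_cases huv with ⟨j, t, ht, rfl, rfl⟩ | h | ⟨j, a, b, hab, rfl, rfl⟩
    · rw [joinDepth_pathVertex h.depth_root j ht.le, joinDepth_pathVertex h.depth_root j ht] at hd
      omega
    · exact .inl h
    · exact .inr ⟨j, a, b, hab, by simp only [joinDepth] at hd; omega, rfl, rfl⟩
  refine ⟨?_, ?_, ?_, ?_⟩
  · rintro (_ | ⟨j, t⟩ | ⟨j, v⟩)
    · exact ⟨fun _ => rfl, fun _ => rfl⟩
    · exact ⟨fun e => absurd e (by simp [joinDepth]), fun e => by cases e⟩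
    · exact ⟨fun e => absurd e (by simp only [joinDepth]; have := hp j; omega), fun e => by cases e⟩
  · intro u v huv
    rcases join_adj_cases huv with ⟨j, t, ht, rfl, rfl⟩ | ⟨j, t, ht, rfl, rfl⟩ |
      ⟨j, a, b, hab, rfl, rfl⟩
    · rw [joinDepth_pathVertex h.depth_root j ht.le, joinDepth_pathVertex h.depth_root j ht]
      exact .inl rfl
    · rw [joinDepth_pathVertex h.depth_root j ht.le, joinDepth_pathVertex h.depth_root j ht]
      exact .inr rfl
    · have := h.adj hab
      simp only [joinDepth]
      omega
  · have path : ∀ (j : Fin q) (t : ℕ), t < p j → ∃ u : JoinVertex q p R.V,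
        (HuntersRabbit.join R p).graph.Adj (pathVertex R p j (t + 1)) u ∧
        joinDepth d (pathVertex R p j (t + 1)) = joinDepth d u + 1 := fun j t ht =>
      ⟨pathVertex R p j t, (join_adj_pathVertex h j ht).symm, by
        rw [joinDepth_pathVertex h.depth_root j ht.le, joinDepth_pathVertex h.depth_root j ht]⟩
    rintro (_ | ⟨j, t⟩ | ⟨j, v⟩) hv
    · exact absurd rfl hv
    · have := path j t (by omega)
      rwa [show pathVertex R p j (t + 1) = .inner j t by simp [pathVertex]] at this
    · by_cases e : v = R.root
      · have := path j (p j - 1) (by have := hp j; omega)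
        rwa [Nat.sub_add_cancel (hp j), pathVertex_root j (hp j), ← e] at this
      · obtain ⟨u, hu, hd⟩ := h.parent v e
        exact ⟨.copy j u, join_adj_copy hu, by simp only [joinDepth]; omega⟩
  · intro u v w hu hw du dw
    rcases down hu du with ⟨j, t, ht, rfl, e⟩ | ⟨j, a, b, hab, hd, rfl, rfl⟩ <;>
      rcases down hw dw with ⟨k, s, hs, rfl, e'⟩ | ⟨k, a', b', hab', hd', e', rfl⟩
    · have h1 : t + 1 = s + 1 := by
        have := congrArg (joinDepth d) (e.symm.trans e')
        rwa [joinDepth_pathVertex h.depth_root j ht, joinDepth_pathVertex h.depth_root k hs] at this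
      have h2 : some j = some k := by
        have := congrArg arm (e.symm.trans e')
        rwa [arm_pathVertex j t.succ_ne_zero, arm_pathVertex k s.succ_ne_zero] at this
      cases h2
      rw [show t = s by omega]
    -- In the two mixed cases the lower vertex is the root of a copy; its depth in `R` is zero, so
    -- it has no parent inside the copy.
    · rw [e] at e'
      have := (h.zero_iff _).2 (pathVertex_succ_eq_copy e').2
      omega
    · have := (h.zero_iff _).2 (pathVertex_succ_eq_copy e'.symm).2
      omega
    · obtain ⟨rfl, rfl⟩ : j = k ∧ a = a' := by simpa using e'
      rw [h.unique hab hab' hd hd']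

theorem isLayering_point : IsLayering point fun _ => 0 :=
  ⟨fun _ => ⟨fun _ => rfl, fun _ => rfl⟩, fun h => h.elim, fun _ h => absurd rfl h,
    fun h => h.elim⟩

end Join

/-! ### The game with an exposed root. -/

/-- One round of the game on a rooted graph whose root is, in addition, contaminated from outside
at every even time: the contaminated set at time `t + 1`, when `S` is shot at time `t`. -/
def exposedStep (R : RootedGraph) (t : ℕ) (S : Finset R.V) (Z : Set R.V) : Set R.V :=
  {x | (∃ y ∈ Z, y ∉ S ∧ R.graph.Adj x y) ∨ (x = R.root ∧ Odd t)}

/-- The contaminated set after the rounds of a list of shots that starts at time `t`. -/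
def exposedRun (R : RootedGraph) : ℕ → List (Finset R.V) → Set R.V → Set R.V
  | _, [], Z => Z
  | t, S :: l, Z => exposedRun R (t + 1) l (exposedStep R t S Z)

/-- Every shot of the list is non-empty and uses at most two hunters. -/
def TwoHunterShots {V : Type*} (l : List (Finset V)) : Prop :=
  ∀ S ∈ l, S.Nonempty ∧ S.card ≤ 2

/-- Two hunters can clear `R` from the even class, except for the root, in an even number of at most
`L` rounds, although the root is exposed to recontamination. -/
def ExposedClearable (R : RootedGraph) (d : R.V → ℕ) (L : ℕ) : Prop :=
  ∃ l : List (Finset R.V), TwoHunterShots l ∧ l.length ≤ L ∧ Even l.length ∧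
    ∀ x ∈ exposedRun R 0 l {v | Even (d v)}, x = R.root

theorem TwoHunterShots.append {V : Type*} {l l' : List (Finset V)} (h : TwoHunterShots l)
    (h' : TwoHunterShots l') : TwoHunterShots (l ++ l') := by
  intro S hS
  rcases List.mem_append.1 hS with hS | hS
  exacts [h S hS, h' S hS]

section Run

variable {R : RootedGraph} {d : R.V → ℕ}

theorem exposedRun_append (t : ℕ) (l l' : List (Finset R.V)) (Z : Set R.V) :
    exposedRun R t (l ++ l') Z = exposedRun R (t + l.length) l' (exposedRun R t l Z) := by
  induction l generalizing t Z with
  | nil => rfl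
  | cons S l ih =>
    simp only [List.cons_append, exposedRun, ih, List.length_cons]
    rw [show t + 1 + l.length = t + (l.length + 1) by omega]

/-- The vertices of a contaminated set have the parity of the time. -/
def InPhase (d : R.V → ℕ) (t : ℕ) (Z : Set R.V) : Prop := ∀ x ∈ Z, Even (d x + t)

theorem InPhase.step (h : IsLayering R d) {t : ℕ} {Z : Set R.V} (hZ : InPhase d t Z)
    (S : Finset R.V) : InPhase d (t + 1) (exposedStep R t S Z) := by
  rintro x (⟨y, hy, -, hxy⟩ | ⟨rfl, ht⟩)
  · have h1 := hZ y hy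
    have h2 := h.adj hxy
    rw [Nat.even_iff] at h1 ⊢
    omega
  · rw [h.depth_root, zero_add]
    exact ht.add_one

theorem InPhase.run (h : IsLayering R d) {t : ℕ} {Z : Set R.V} (hZ : InPhase d t Z)
    (l : List (Finset R.V)) : InPhase d (t + l.length) (exposedRun R t l Z) := by
  induction l generalizing t Z with
  | nil => exact hZ
  | cons S l ih =>
    have := ih (hZ.step h S)
    rwa [show t + 1 + l.length = t + (S :: l).length by simp; omega] at this

end Run

/-! ### Clearing a join with two hunters. -/

section Join

variable {R : RootedGraph} {q : ℕ} {p : Fin q → ℕ} {d : R.V → ℕ}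

/-- The contaminated vertices of the branch `j` have depth at most `m`. -/
def ArmBound (d : R.V → ℕ) (j : Fin q) (m : ℕ) (Z : Set (join R p).V) : Prop :=
  ∀ x : JoinVertex q p R.V, x ∈ Z → arm x = some j → joinDepth d x ≤ m

theorem ArmBound.mono {j : Fin q} {m n : ℕ} {Z : Set (join R p).V} (h : ArmBound d j m Z)
    (hmn : m ≤ n) : ArmBound d j n Z := fun x hx ha => (h x hx ha).trans hmn

theorem ArmBound.step (h : IsLayering R d) (hp : ∀ j, 0 < p j) {j : Fin q} {m : ℕ}
    {Z : Set (join R p).V} (hZ : ArmBound d j m Z) (t : ℕ) (S : Finset (join R p).V) :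
    ArmBound d j (m + 1) (exposedStep (join R p) t S Z) := by
  rintro x (⟨y, hy, -, hxy⟩ | ⟨rfl, -⟩) ha
  · have hd := (h.join hp).adj hxy
    rcases join_adj_arm hxy ha with rfl | hy'
    · simp only [joinDepth] at hd ⊢
      omega
    · have := hZ y hy hy'
      omega
  · simp [join, arm] at ha

theorem ArmBound.run (h : IsLayering R d) (hp : ∀ j, 0 < p j) {j : Fin q} {m : ℕ}
    {Z : Set (join R p).V} (hZ : ArmBound d j m Z) (t : ℕ) (l : List (Finset (join R p).V)) :
    ArmBound d j (m + l.length) (exposedRun (join R p) t l Z) := by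
  induction l generalizing t Z m with
  | nil => exact hZ
  | cons S l ih => exact (ih (hZ.step h hp t S) (t + 1)).mono (by simp; omega)

/-- A clean branch stays clean while the center is shot. -/
theorem ArmBound.step_zero (h : IsLayering R d) (hp : ∀ j, 0 < p j) {j : Fin q}
    {Z : Set (join R p).V} (hZ : ArmBound d j 0 Z) (t : ℕ) {S : Finset (join R p).V}
    (hS : (join R p).root ∈ S) : ArmBound d j 0 (exposedStep (join R p) t S Z) := by
  rintro x (⟨y, hy, hyS, hxy⟩ | ⟨rfl, -⟩) ha
  · rcases join_adj_arm hxy ha with rfl | hy'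
    · exact absurd hS hyS
    · have h0 := hZ y hy hy'
      have := ((h.join hp).zero_iff y).1 (by omega)
      exact absurd hS (this ▸ hyS)
  · simp [join, arm] at ha

theorem ArmBound.run_zero (h : IsLayering R d) (hp : ∀ j, 0 < p j) {j : Fin q}
    {Z : Set (join R p).V} (hZ : ArmBound d j 0 Z) (t : ℕ) {l : List (Finset (join R p).V)}
    (hl : ∀ S ∈ l, (join R p).root ∈ S) : ArmBound d j 0 (exposedRun (join R p) t l Z) := by
  induction l generalizing t Z with
  | nil => exact hZ
  | cons S l ih =>
    exact ih (hZ.step_zero h hp t (hl S (by simp))) (t + 1) fun S hS => hl S (by simp [hS])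

/-- Shooting the deepest contaminated vertex of a branch lowers the depth bound by one. -/
theorem ArmBound.step_sweep (h : IsLayering R d) (hp : ∀ j, 0 < p j) {j : Fin q} {m t : ℕ}
    {Z : Set (join R p).V} (hZ : ArmBound d j (m + 1) Z)
    (hph : InPhase (R := join R p) (joinDepth d) t Z)
    (hm : m + 1 ≤ p j) (ht : Even (m + 1 + t)) {S : Finset (join R p).V}
    (hS : pathVertex R p j (m + 1) ∈ S) : ArmBound d j m (exposedStep (join R p) t S Z) := by
  rintro x (⟨y, hy, hyS, hxy⟩ | ⟨rfl, -⟩) ha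
  · have hd := (h.join hp).adj hxy
    -- Contaminated depths all have the parity of `m + 1`. Once depth `m + 1` is shot, the others
    -- are at most `m - 1` and move to at most `m`. The center can only infect depth 1, and when it
    -- is contaminated `m` is odd.
    have hph := hph y hy
    rw [Nat.even_iff] at hph ht
    rcases join_adj_arm hxy ha with rfl | hy'
    · simp only [joinDepth] at hd hph ⊢
      omega
    · have h1 := hZ y hy hy'
      have h2 : joinDepth d y ≠ m + 1 := by
        intro e
        have := eq_pathVertex h (hp j) hy' (h1.trans hm)
        rw [e] at this
        exact hyS (this ▸ hS)
      omega
  · simp [join, arm] at ha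

/-- One hunter walks along the path from depth `m` towards the center, lowering the bound each
round. The other stays on the center, which keeps the branches that are already clean from being
infected. -/
theorem exists_sweep_arm (h : IsLayering R d) (hp : ∀ j, 0 < p j) (j : Fin q) (m : ℕ)
    (hm : m ≤ p j) (t : ℕ) (ht : Even (m + t)) (Z : Set (join R p).V) (hZ : ArmBound d j m Z)
    (hph : InPhase (R := join R p) (joinDepth d) t Z) :
    ∃ l : List (Finset (join R p).V), TwoHunterShots l ∧ l.length = m ∧
      (∀ S ∈ l, (join R p).root ∈ S) ∧ ArmBound d j 0 (exposedRun (join R p) t l Z) := by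
  classical
  induction m generalizing t Z with
  | zero => exact ⟨[], by simp [TwoHunterShots], rfl, by simp, hZ⟩
  | succ m ih =>
    let S : Finset (join R p).V := {(join R p).root, pathVertex R p j (m + 1)}
    obtain ⟨l, h1, h2, h3, h4⟩ := ih (by omega) (t + 1) (by convert ht using 1; omega) _
      (hZ.step_sweep h hp hph hm ht (S := S) (Finset.mem_insert_of_mem (Finset.mem_singleton_self _))) (hph.step (h.join hp) S)
    refine ⟨S :: l, ?_, by simp [h2], ?_, h4⟩
    · intro S' hS'
      rcases List.mem_cons.1 hS' with rfl | hS'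
      · exact ⟨⟨(join R p).root, by simp [S]⟩, Finset.card_le_two⟩
      · exact h1 S' hS'
    · intro S' hS'
      rcases List.mem_cons.1 hS' with rfl | hS'
      · simp [S]
      · exact h3 S' hS'

/-- While earlier branches are swept, contamination in branch `k` advances one edge per round; `hB`
ensures that it is still on the path when the turn of `k` comes. -/
theorem exists_sweep_arms (h : IsLayering R d) (hp : ∀ j, 0 < p j) (hev : ∀ j, Even (p j))
    (js : List (Fin q)) (hjs : js.Pairwise (· < ·)) (t : ℕ) (ht : Even t)
    (Z : Set (join R p).V) (B : Fin q → ℕ) (hZ : ∀ k ∈ js, ArmBound d k (B k) Z)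
    (hB : ∀ k ∈ js, B k + ∑ i with i < k ∧ i ∈ js, p i ≤ p k)
    (hph : InPhase (R := join R p) (joinDepth d) t Z) :
    ∃ l : List (Finset (join R p).V), TwoHunterShots l ∧ l.length = (js.map p).sum ∧
      ∀ k, (k ∈ js ∨ ArmBound d k 0 Z) → ArmBound d k 0 (exposedRun (join R p) t l Z) := by
  induction js generalizing t Z B with
  | nil => exact ⟨[], by simp [TwoHunterShots], rfl, by simp [exposedRun]⟩
  | cons j js ih =>
    rw [List.pairwise_cons] at hjs
    have hj : B j ≤ p j := (Nat.le_add_right _ _).trans (hB j (by simp))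
    -- The sweep starts at depth `p j` rather than `B j`: `p j` is even, as the phase requires, and
    -- the duration is then exactly `p j`.
    obtain ⟨l, h1, h2, h3, h4⟩ := exists_sweep_arm h hp j (p j) le_rfl t ((hev j).add ht) Z
      ((hZ j (by simp)).mono hj) hph
    obtain ⟨l', h1', h2', h3'⟩ := ih hjs.2 (t + l.length) (by rw [h2]; exact ht.add (hev j))
      (exposedRun (join R p) t l Z) (fun k => B k + p j)
      (fun k hk => by
        have := (hZ k (by simp [hk])).run h hp t l
        rwa [h2] at this)
      (fun k hk => by
        refine le_trans ?_ (hB k (by simp [hk]))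
        have : (Finset.univ.filter fun i => i < k ∧ i ∈ j :: js) =
            insert j (Finset.univ.filter fun i => i < k ∧ i ∈ js) := by
          ext i
          simp only [Finset.mem_filter, Finset.mem_univ, true_and, List.mem_cons, Finset.mem_insert]
          constructor
          · tauto
          · rintro (rfl | ⟨h, h'⟩)
            · exact ⟨hjs.1 k hk, .inl rfl⟩
            · exact ⟨h, .inr h'⟩
        rw [this, Finset.sum_insert]
        · omega
        · simp only [Finset.mem_filter, not_and]
          exact fun _ _ hmem => lt_irrefl _ (hjs.1 j hmem))
      (hph.run (h.join hp) l)
    refine ⟨l ++ l', h1.append h1', by simp [h2, h2'], fun k hk => ?_⟩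
    rw [exposedRun_append]
    apply h3'
    rcases hk with hk | hk
    · rcases List.mem_cons.1 hk with rfl | hk
      · exact .inr h4
      · exact .inl hk
    · exact .inr (ArmBound.run_zero h hp hk t h3)

/-- The inclusion of a copy of `R` in a join. -/
def copyEmbedding (j : Fin q) : R.V ↪ (join R p).V :=
  ⟨.copy j, fun _ _ e => (JoinVertex.copy.inj e).2⟩

/-- A strategy for `R` can be played in a copy of `R` in a join. -/
theorem mem_exposedRun_of_copy (h : IsLayering R d)
    (hp : ∀ j, 0 < p j) (j : Fin q)
    (hev : Even (p j)) (l : List (Finset R.V)) (s t : ℕ) (hst : Even (s + t))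
    (A : Set R.V) (Z : Set (join R p).V) (hph : InPhase (R := join R p) (joinDepth d) t Z)
    (hZ : ∀ v, (.copy j v : JoinVertex q p R.V) ∈ Z → v ∈ A) (v : R.V)
    (hv : (.copy j v : JoinVertex q p R.V) ∈ exposedRun (join R p) t
      (l.map (Finset.map (copyEmbedding j))) Z) :
    v ∈ exposedRun R s l A := by
  induction l generalizing s t A Z with
  | nil => exact hZ v hv
  | cons S l ih =>
    refine ih (s + 1) (t + 1) (by rw [Nat.even_iff] at hst ⊢; omega) _ _
      (hph.step (h.join hp) _) ?_ hv
    rintro v (⟨y, hy, hyS, hvy⟩ | ⟨e, -⟩)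
    · rcases adj_of_join_adj_copy hvy with rfl | ⟨u, rfl, huv⟩
      -- The infection comes from outside the copy. By parity it reaches the root of the copy only
      -- at even times, which is what `exposedStep` allows for.
      · refine .inr ⟨rfl, ?_⟩
        have h1 := hph y hy
        have h2 : joinDepth d y = p j + 1 ∨ p j = joinDepth d y + 1 := by
          simpa [joinDepth, h.depth_root] using (h.join hp).adj hvy
        rw [Nat.even_iff] at h1 hst hev
        rw [Nat.odd_iff]
        omega
      · exact .inl ⟨u, hZ u hy, fun hu => hyS (Finset.mem_map_of_mem (copyEmbedding j) hu), huv⟩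
    · cases e

/-- The strategy for `R` is played in copy `j`, then the paths `j, j + 1, …` are swept. This clears
branch `j` and repairs the damage done to the later ones in the meantime. -/
theorem exists_clear_branch (h : IsLayering R d) (hp : ∀ j, 0 < p j) (hev : ∀ j, Even (p j))
    {L : ℕ} (hL : ∀ j k : Fin q, j < k → L + ∑ i with i < k, p i ≤ p k)
    (hR : ExposedClearable R d L) (j : Fin q) (t : ℕ) (ht : Even t) (Z : Set (join R p).V)
    (hph : InPhase (R := join R p) (joinDepth d) t Z) (hZ : ∀ k, j < k → ArmBound d k 0 Z) :
    ∃ l : List (Finset (join R p).V), TwoHunterShots l ∧ l.length ≤ L + ∑ k with j ≤ k, p k ∧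
      Even l.length ∧ ∀ k, j ≤ k → ArmBound d k 0 (exposedRun (join R p) t l Z) := by
  classical
  obtain ⟨l, h1, h2, h3, h4⟩ := hR
  let l₁ : List (Finset (join R p).V) := l.map (Finset.map (copyEmbedding j))
  have hl₁ : l₁.length = l.length := by simp [l₁]
  let js := (List.finRange q).filter fun k => j ≤ k
  have hjs : ∀ k, k ∈ js ↔ j ≤ k := fun k => by simp [js]
  have hsum : (js.map p).sum = ∑ k with j ≤ k, p k := by
    have hnd : js.Nodup := (List.nodup_finRange q).filter _
    rw [← List.sum_toFinset p hnd]
    congr 1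
    ext k
    simp [js]
  have hcopy : ∀ v, (.copy j v : JoinVertex q p R.V) ∈ exposedRun (join R p) t l₁ Z →
      v = R.root := fun v hv => h4 v <| mem_exposedRun_of_copy h hp j (hev j) l 0 t (by simpa) _ Z
    hph (fun v hv => by
      have := hph _ hv
      have h' := hev j
      simp only [joinDepth, Set.mem_ofPred_eq] at this ⊢
      rw [Nat.even_iff] at this ht h' ⊢
      omega) v hv
  obtain ⟨l₂, g1, g2, g3⟩ := exists_sweep_arms h hp hev js
    ((List.pairwise_lt_finRange q).filter _) (t + l₁.length) (by rw [hl₁]; exact ht.add h3)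
    -- After the play in copy `j`, only the root of that copy may remain contaminated in it, at
    -- depth `p j`. A later branch was clean and has been exposed for at most `L` rounds.
    (exposedRun (join R p) t l₁ Z) (fun k => if j < k then L else p j)
    (fun k hk => by
      split_ifs with hjk
      · exact ((hZ k hjk).run h hp t l₁).mono (by omega)
      · obtain rfl : j = k := le_antisymm ((hjs k).1 hk) (not_lt.1 hjk)
        rintro (_ | ⟨i, s⟩ | ⟨i, v⟩) hx ha
        · simp [arm] at ha
        · obtain rfl : i = j := by simpa [arm] using ha
          simp only [joinDepth]
          omega
        · obtain rfl : i = j := by simpa [arm] using ha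
          rw [hcopy v hx]
          simp [joinDepth, h.depth_root])
    (fun k hk => by
      split_ifs with hjk
      · refine le_trans ?_ (hL j k hjk)
        gcongr
        exact fun h => h.1
      · obtain rfl : j = k := le_antisymm ((hjs k).1 hk) (not_lt.1 hjk)
        rw [Finset.sum_eq_zero]
        · simp
        · intro i hi
          simp only [Finset.mem_filter, hjs] at hi
          exact absurd hi.2.1 (not_lt.2 hi.2.2))
    (hph.run (h.join hp) l₁)
  refine ⟨l₁ ++ l₂, TwoHunterShots.append ?_ g1, ?_, ?_, fun k hk => ?_⟩
  · intro S hS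
    obtain ⟨S', hS', rfl⟩ := List.mem_map.1 hS
    exact ⟨(h1 S' hS').1.map, (Finset.card_map _).trans_le (h1 S' hS').2⟩
  · rw [List.length_append, g2, hsum, hl₁]
    omega
  · rw [List.length_append, g2, hsum, hl₁]
    exact h3.add (Finset.even_sum _ fun k _ => hev k)
  · rw [exposedRun_append]
    exact g3 k (.inl ((hjs k).2 hk))

/-- The branches of a join are cleared in decreasing order; after each one, the paths to the copies
that have been cleared before are swept again, while the center is guarded. -/
theorem exposedClearable_join (h : IsLayering R d) (hp : ∀ j, 0 < p j) (hev : ∀ j, Even (p j))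
    {L : ℕ} (hL : ∀ j k : Fin q, j < k → L + ∑ i with i < k, p i ≤ p k)
    (hR : ExposedClearable R d L) :
    ExposedClearable (join R p) (joinDepth d) (q * L + ∑ j : Fin q, ((j : ℕ) + 1) * p j) := by
  have hph : InPhase (R := join R p) (joinDepth d) 0 {v | Even (joinDepth d v)} :=
    fun x hx => hx
  -- `n` counts the branches already cleared, those with the largest indices.
  have key : ∀ n ≤ q, ∃ l : List (Finset (join R p).V), TwoHunterShots l ∧
      l.length ≤ n * L + ∑ j ∈ Finset.univ.filter (fun j : Fin q => q ≤ n + j), ∑ k with j ≤ k, p k ∧ Even l.length ∧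
      ∀ k : Fin q, q ≤ n + k →
        ArmBound d k 0 (exposedRun (join R p) 0 l {v | Even (joinDepth d v)}) := by
    intro n hn
    induction n with
    | zero =>
      refine ⟨[], by simp [TwoHunterShots], by simp, by simp, fun k hk => ?_⟩
      have := k.2
      omega
    | succ n ih =>
      obtain ⟨l, h1, h2, h3, h4⟩ := ih (by omega)
      let j : Fin q := ⟨q - (n + 1), by omega⟩
      obtain ⟨l', g1, g2, g3, g4⟩ := exists_clear_branch h hp hev hL hR j (0 + l.length)
        (by simpa using h3) _ (hph.run (h.join hp) l) fun k hk => h4 k (by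
          have : q - (n + 1) < k := hk
          omega)
      refine ⟨l ++ l', h1.append g1, ?_, by rw [List.length_append]; exact h3.add g3,
        fun k hk => ?_⟩
      · have : (Finset.univ.filter fun i : Fin q => q ≤ n + 1 + i) =
            insert j (Finset.univ.filter fun i : Fin q => q ≤ n + i) := by
          ext i
          simp only [Finset.mem_filter, Finset.mem_univ, true_and, Finset.mem_insert, Fin.ext_iff, j]
          omega
        rw [this, Finset.sum_insert (by simp [j]; omega), List.length_append, add_mul, one_mul]
        omega
      · rw [exposedRun_append]
        refine g4 k ?_
        change q - (n + 1) ≤ (k : ℕ)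
        omega
  obtain ⟨l, h1, h2, h3, h4⟩ := key q le_rfl
  refine ⟨l, h1, h2.trans (Nat.add_le_add_left (le_of_eq ?_) _), h3, ?_⟩
  · rw [Finset.filter_true_of_mem fun j _ => by omega]
    -- Double counting: path `k` is swept once for each `j ≤ k`, that is `k + 1` times.
    simp only [Finset.sum_filter]
    rw [Finset.sum_comm]
    refine Finset.sum_congr rfl fun k _ => ?_
    rw [← Finset.sum_filter, Finset.sum_const, smul_eq_mul]
    congr 1
    rw [show (Finset.univ.filter fun j : Fin q => j ≤ k) = Finset.Iic k by ext; simp]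
    exact Fin.card_Iic k
  · rintro (_ | ⟨j, s⟩ | ⟨j, v⟩) hx
    · rfl
    · have := h4 j (by omega) _ hx rfl
      simp [joinDepth] at this
    · have := h4 j (by omega) _ hx rfl
      have h' := hp j
      simp only [joinDepth] at this
      omega

/-- At even times a leg is contaminated only at even depths, so at depth at most 2. Two rounds sweep
it, and the guard on the center protects the legs already done. -/
theorem exposedClearable_spider (q : ℕ) :
    ExposedClearable (spider 3 q) (joinDepth fun _ => 0) (4 * q) := by
  have h := isLayering_point
  have hp : ∀ _ : Fin q, 0 < 3 := fun _ => by norm_num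
  have hph : InPhase (R := spider 3 q) (joinDepth fun _ => 0) 0
    {v | Even (joinDepth (R := point) (fun _ => 0) v)} := fun x hx => hx
  have key : ∀ n ≤ q, ∃ l : List (Finset (spider 3 q).V), TwoHunterShots l ∧
      l.length = 2 * n ∧
      ∀ k : Fin q, k < n → ArmBound (R := point) (p := fun _ => 3) (fun _ => 0) k 0
        (exposedRun (spider 3 q) 0 l {v | Even (joinDepth (R := point) (fun _ => 0) v)}) := by
    intro n hn
    induction n with
    | zero => exact ⟨[], by simp [TwoHunterShots], rfl, by simp⟩
    | succ n ih =>
      obtain ⟨l, h1, h2, h4⟩ := ih (by omega)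
      have hph' := hph.run (h.join hp) l
      obtain ⟨(l' : List (Finset (spider 3 q).V)), g1, g2, g3, g4⟩ := exists_sweep_arm (R := point) (p := fun _ : Fin q => 3) h hp
        ⟨n, by omega⟩ 2 (by norm_num) (0 + l.length) (by rw [h2, Nat.even_iff]; omega) _
        (fun x hx _ => by
          have h1 : Even (joinDepth (R := point) (fun _ => 0) x + (0 + l.length)) := hph' x hx
          have h3 : joinDepth (R := point) (fun _ => 0) x ≤ 3 := by
            rcases x with _ | ⟨j, s⟩ | ⟨j, v⟩ <;> simp only [joinDepth] <;> omega
          rw [h2, Nat.even_iff] at h1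
          omega) hph'
      refine ⟨l ++ l', h1.append g1, by rw [List.length_append, h2]; exact congrArg (2 * n + ·) g2, fun k hk => ?_⟩
      rw [exposedRun_append]
      rcases Nat.lt_succ_iff_lt_or_eq.1 hk with hk | hk
      · exact (h4 k hk).run_zero h hp _ g3
      · rwa [show k = ⟨n, by omega⟩ from Fin.ext hk]
  obtain ⟨l, h1, h2, h4⟩ := key q le_rfl
  refine ⟨l, h1, by omega, by simp [h2], ?_⟩
  rintro (_ | ⟨j, s⟩ | ⟨j, v⟩) hx
  · rfl
  · have := h4 j j.2 _ hx rfl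
    simp [joinDepth] at this
  · have := h4 j j.2 _ hx rfl
    simp [joinDepth] at this

end Join

/-! ### Contaminated sets and rabbit walks. -/

section Game

variable {V : Type*} {G : SimpleGraph V} {W : Set V} {S : HunterStrategy V}

theorem exists_walk_of_mem_contaminated (n : ℕ) {x : V} (hx : x ∈ contaminated G W S n) :
    ∃ r : ℕ → V, r 0 ∈ W ∧ (∀ i < n, G.Adj (r i) (r (i + 1))) ∧ (∀ i < n, r i ∉ S.shot (i + 1)) ∧
      r n = x := by
  induction n generalizing x with
  | zero => exact ⟨fun _ => x, hx, by simp, by simp, rfl⟩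
  | succ n ih =>
    obtain ⟨y, hy, hyS, hxy⟩ := hx
    obtain ⟨r, h0, h1, h2, rfl⟩ := ih hy
    refine ⟨fun i => if i ≤ n then r i else x, by simpa, fun i hi => ?_, fun i hi => ?_, by simp⟩
    · rcases Nat.lt_succ_iff_lt_or_eq.1 hi with hi | rfl
      · simpa [hi.le, Nat.succ_le_of_lt hi] using h1 i hi
      · simpa using hxy.symm
    · rcases Nat.lt_succ_iff_lt_or_eq.1 hi with hi | rfl
      · simpa [hi.le] using h2 i hi
      · simpa using hyS

theorem mem_contaminated_of_walk (r : ℕ → V) (n : ℕ) (h0 : r 0 ∈ W)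
    (h1 : ∀ i < n, G.Adj (r i) (r (i + 1))) (h2 : ∀ i < n, r i ∉ S.shot (i + 1)) :
    r n ∈ contaminated G W S n := by
  induction n with
  | zero => exact h0
  | succ n ih =>
    exact ⟨r n, ih (fun i hi => h1 i (by omega)) (fun i hi => h2 i (by omega)), h2 n (by omega),
      (h1 n (by omega)).symm⟩

theorem winning_iff_contaminated : Winning G W S ↔ contaminated G W S S.length = ∅ := by
  constructor
  · intro h
    by_contra hne
    obtain ⟨x, hx⟩ := Set.nonempty_iff_ne_empty.2 hne
    obtain ⟨r, h0, h1, h2, -⟩ := exists_walk_of_mem_contaminated _ hx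
    obtain ⟨j, hj, hj'⟩ := h r h0 h1
    exact h2 j hj hj'
  · intro h r h0 h1
    by_contra! h2
    have := mem_contaminated_of_walk r _ h0 h1 h2
    rw [h] at this
    exact this

theorem contaminated_eq_empty_of_le {m n : ℕ} (h : contaminated G W S m = ∅) (hmn : m ≤ n) :
    contaminated G W S n = ∅ := by
  induction n, hmn using Nat.le_induction with
  | base => exact h
  | succ n _ ih =>
    refine Set.eq_empty_iff_forall_notMem.2 ?_
    rintro x ⟨y, hy, -⟩
    rw [ih] at hy
    exact hy

end Game

/-! ### One hunter cannot clear a spider. -/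

/-- A spider with three legs of three edges, centered at `c`. -/
structure IsSpider {V : Type*} (G : SimpleGraph V) (c : V) (a b e : Fin 3 → V) : Prop where
  inj_a : Function.Injective a
  inj_b : Function.Injective b
  ne_ae : ∀ i, a i ≠ e i
  ne_bc : ∀ i, b i ≠ c
  adj_ca : ∀ i, G.Adj c (a i)
  adj_ab : ∀ i, G.Adj (a i) (b i)
  adj_be : ∀ i, G.Adj (b i) (e i)

section OneHunter

variable {V : Type*} {G : SimpleGraph V} {W : Set V} {S : HunterStrategy V}
  {c : V} {a b e : Fin 3 → V}

/-- An invariant over two rounds against single shots. A contaminated `b i` makes `a i` contaminated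
after one round, whatever is shot; two such vertices reinfect `c`, since one shot cannot stop both.
An unshot `b i` is reinfected from `a i` or `e i`. -/
theorem IsSpider.contaminated_add_two (h : IsSpider G c a b e) {n : ℕ} {s s' : V}
    (hs : ∀ v ∈ S.shot (n + 1), v = s) (hs' : ∀ v ∈ S.shot (n + 2), v = s')
    (hc : c ∈ contaminated G W S n)
    (hb : ∃ i j, i ≠ j ∧ b i ∈ contaminated G W S n ∧ b j ∈ contaminated G W S n) :
    c ∈ contaminated G W S (n + 2) ∧
    ∃ i j, i ≠ j ∧ b i ∈ contaminated G W S (n + 2) ∧ b j ∈ contaminated G W S (n + 2) := by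
  have step1 : ∀ {x y}, y ∈ contaminated G W S n → y ≠ s → G.Adj x y →
      x ∈ contaminated G W S (n + 1) := fun hy hne hxy => ⟨_, hy, fun h => hne (hs _ h), hxy⟩
  have step2 : ∀ {x y z}, y ∈ contaminated G W S (n + 1) → z ∈ contaminated G W S (n + 1) →
      y ≠ z → G.Adj x y → G.Adj x z → x ∈ contaminated G W S (n + 2) := by
    intro x y z hy hz hyz hxy hxz
    by_cases hys : y = s'
    · exact ⟨z, hz, fun h => hyz (hys.trans (hs' _ h).symm), hxz⟩
    · exact ⟨y, hy, fun h => hys (hs' _ h), hxy⟩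
  have ha : ∀ i, b i ∈ contaminated G W S n → a i ∈ contaminated G W S (n + 1) := by
    intro i hi
    by_cases hcs : c = s
    · exact step1 hi (hcs ▸ h.ne_bc i) (h.adj_ab i)
    · exact step1 hc hcs (h.adj_ca i).symm
  have hbb : ∀ i, b i ∈ contaminated G W S n → b i ≠ s → b i ∈ contaminated G W S (n + 2) :=
    fun i hi hne => step2 (ha i hi) (step1 hi hne (h.adj_be i).symm) (h.ne_ae i)
      (h.adj_ab i).symm (h.adj_be i)
  have hshot : ∀ i j, i ≠ j → b i ∈ contaminated G W S n → b j ∈ contaminated G W S n →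
      b i = s → ∃ i j, i ≠ j ∧ b i ∈ contaminated G W S (n + 2) ∧
        b j ∈ contaminated G W S (n + 2) := by
    -- The shot at `b i` spares `c`, so every `a k` becomes contaminated. If the next shot hits `a
    -- i`, the third leg supplies the replacement for `b i`.
    intro i j hij hi hj hbs
    have ha' : ∀ k, a k ∈ contaminated G W S (n + 1) := fun k =>
      step1 hc (fun h' => h.ne_bc i (hbs.trans h'.symm)) (h.adj_ca k).symm
    have hj' : b j ∈ contaminated G W S (n + 2) :=
      hbb j hj fun h' => hij (h.inj_b (hbs.trans h'.symm))
    obtain ⟨k, hki, hkj⟩ : ∃ k, k ≠ i ∧ k ≠ j :=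
      (by decide : ∀ i j : Fin 3, ∃ k, k ≠ i ∧ k ≠ j) i j
    by_cases has : a i = s'
    · exact ⟨k, j, hkj, ⟨a k, ha' k, fun h' => hki (h.inj_a ((hs' _ h').trans has.symm)),
        (h.adj_ab k).symm⟩, hj'⟩
    · exact ⟨i, j, hij, ⟨a i, ha' i, fun h' => has (hs' _ h'), (h.adj_ab i).symm⟩, hj'⟩
  obtain ⟨i, j, hij, hi, hj⟩ := hb
  refine ⟨step2 (ha i hi) (ha j hj) (fun h' => hij (h.inj_a h')) (h.adj_ca i) (h.adj_ca j), ?_⟩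
  by_cases h1 : b i = s
  · exact hshot i j hij hi hj h1
  · by_cases h2 : b j = s
    · exact hshot j i hij.symm hj hi h2
    · exact ⟨i, j, hij, hbb i hi h1, hbb j hj h2⟩

theorem IsSpider.two_le_hunters (h : IsSpider G c a b e) (hc : c ∈ W) (hb : ∀ i, b i ∈ W)
    (hS : Winning G W S) : 2 ≤ S.hunters := by
  by_contra! hlt
  have hone : ∀ i, i < S.length → ∃ s, ∀ v ∈ S.shot (i + 1), v = s := by
    intro i hi
    have h1 : (S.shot (i + 1)).card ≤ S.hunters :=
      Finset.le_sup (f := fun i => (S.shot i).card) (Finset.mem_Icc.2 ⟨by omega, hi⟩)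
    obtain ⟨v, hv⟩ := S.nonempty (i + 1) (by omega) hi
    exact ⟨v, fun w hw => Finset.card_le_one.1 (by omega) w hw v hv⟩
  have key : ∀ n, 2 * n ≤ S.length → c ∈ contaminated G W S (2 * n) ∧
      ∃ i j, i ≠ j ∧ b i ∈ contaminated G W S (2 * n) ∧ b j ∈ contaminated G W S (2 * n) := by
    intro n hn
    induction n with
    | zero => exact ⟨hc, 0, 1, by decide, hb 0, hb 1⟩
    | succ n ih =>
      obtain ⟨h1, h2⟩ := ih (by omega)
      obtain ⟨s, hs⟩ := hone (2 * n) (by omega)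
      obtain ⟨s', hs'⟩ := hone (2 * n + 1) (by omega)
      exact h.contaminated_add_two hs hs' h1 h2
  rw [winning_iff_contaminated] at hS
  obtain ⟨n, hn | hn⟩ := S.length.even_or_odd'
  · have := (key n hn.ge).1
    rw [← hn, hS] at this
    exact this
  · obtain ⟨h1, i, -, -, h2, -⟩ := key n (by omega)
    obtain ⟨s, hs⟩ := hone (2 * n) (by omega)
    have : a i ∈ contaminated G W S (2 * n + 1) := by
      by_cases hcs : c = s
      · exact ⟨b i, h2, fun h' => h.ne_bc i ((hs _ h').trans hcs.symm), h.adj_ab i⟩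
      · exact ⟨c, h1, fun h' => hcs (hs _ h'), (h.adj_ca i).symm⟩
    rw [← hn, hS] at this
    exact this

end OneHunter

/-! ### Clearings and their outer boundaries. -/

section Clearing

variable {V : Type*} {G : SimpleGraph V}

/-- The vertices outside of `A` with a neighbour in `A`. -/
def outerBoundary (G : SimpleGraph V) (A : Set V) : Set V := {x | x ∉ A ∧ ∃ y ∈ A, G.Adj x y}

/-- A decreasing sequence of vertex sets from the whole vertex set to the empty set such that no
step removes both ends of an edge. -/
structure IsClearing (G : SimpleGraph V) (A : ℕ → Set V) : Prop where
  antitone : Antitone A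
  zero : A 0 = Set.univ
  empty : ∃ n, A n = ∅
  edge : ∀ {x y} (t : ℕ), G.Adj x y → x ∈ A t → y ∈ A t → x ∈ A (t + 1) ∨ y ∈ A (t + 1)

/-- Every clearing has at some time an outer boundary of at least `k` vertices; this lower bound
plays the role of a bound on the pathwidth. -/
def BoundaryAtLeast (G : SimpleGraph V) (k : ℕ) : Prop :=
  ∀ A : ℕ → Set V, IsClearing G A → ∃ t, k ≤ (outerBoundary G (A t)).ncard

theorem mem_of_reachable {A : Set V} (hA : ∀ x ∈ A, ∀ y, G.Adj x y → y ∈ A) {u v : V}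
    (huv : G.Reachable u v) (hu : u ∈ A) : v ∈ A := by
  obtain ⟨w⟩ := huv
  induction w with
  | nil => exact hu
  | cons h _ ih => exact ih (hA _ hu _ h)

/-- At the first time the set is not everything, the edge condition keeps it non-empty, so
connectedness provides a boundary vertex. -/
theorem boundaryAtLeast_one [Finite V] (hG : G.Connected) {u v : V} (huv : G.Adj u v) :
    BoundaryAtLeast G 1 := by
  classical
  intro A hA
  have hex : ∃ n, A n ≠ Set.univ := by
    obtain ⟨n, hn⟩ := hA.empty
    exact ⟨n, fun h => by rw [hn] at h; exact (h ▸ Set.mem_univ u : u ∈ (∅ : Set V))⟩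
  obtain ⟨n, hn⟩ : ∃ n, Nat.find hex = n + 1 :=
    Nat.exists_eq_succ_of_ne_zero fun h => Nat.find_spec hex (h ▸ hA.zero)
  have hn1 : A (n + 1) ≠ Set.univ := hn ▸ Nat.find_spec hex
  have hn0 : A n = Set.univ := not_not.1 (Nat.find_min hex (show n < _ by omega))
  obtain ⟨w, hw⟩ : (A (n + 1)).Nonempty := by
    rcases hA.edge n huv (by simp [hn0]) (by simp [hn0]) with h | h <;> exact ⟨_, h⟩
  refine ⟨n + 1, (Set.ncard_pos (Set.toFinite _)).2 ?_⟩
  by_contra hemp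
  refine hn1 (Set.eq_univ_of_forall fun x => mem_of_reachable ?_ (hG w x) hw)
  intro x hx y hxy
  by_contra hy
  exact hemp ⟨y, hy, x, hx, hxy.symm⟩

end Clearing

/-! ### Growth of the boundary under joins. -/

section Join

variable {R : RootedGraph} {q : ℕ} {p : Fin q → ℕ} {d : R.V → ℕ}

theorem IsClearing.copy {A : ℕ → Set (join R p).V} (hA : IsClearing (join R p).graph A)
    (j : Fin q) :
    IsClearing R.graph fun t => {v | (.copy j v : JoinVertex q p R.V) ∈ A t} where
  antitone _ _ h _ hv := hA.antitone h hv
  zero := Set.eq_univ_of_forall fun v => by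
    change _ ∈ A 0
    rw [hA.zero]
    trivial
  empty := by
    obtain ⟨n, hn⟩ := hA.empty
    refine ⟨n, Set.eq_empty_of_forall_notMem fun v hv => ?_⟩
    change _ ∈ A n at hv
    rw [hn] at hv
    exact hv
  edge t hxy := hA.edge t (join_adj_copy hxy)

/-- Two copies in a join are connected by a path that avoids a third one. -/
theorem exists_outerBoundary_of_copies (h : IsLayering R d) (hp : ∀ j, 0 < p j) {i j k : Fin q}
    (hij : i ≠ j) (hkj : k ≠ j) {A : Set (join R p).V} {u v : R.V}
    (hu : (.copy i u : JoinVertex q p R.V) ∉ A) (hv : (.copy k v : JoinVertex q p R.V) ∈ A) :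
    ∃ x ∈ outerBoundary (join R p).graph A, ∀ w, x ≠ .copy j w := by
  by_contra! hcon
  -- Without such a boundary vertex, membership in `A` propagates outside copy `j`: through copy
  -- `k`, up to the center, and down into copy `i`.
  have closed : ∀ (x y : JoinVertex q p R.V), x ∈ A → (join R p).graph.Adj x y →
      (∀ w, y ≠ .copy j w) → y ∈ A := by
    intro x y hx hxy hy
    by_contra hyA
    obtain ⟨w, hw⟩ := hcon y ⟨hyA, x, hx, hxy.symm⟩
    exact hy w hw
  have inCopy : ∀ {m : Fin q}, m ≠ j → ∀ {a b : R.V}, (.copy m a : JoinVertex q p R.V) ∈ A →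
      (.copy m b : JoinVertex q p R.V) ∈ A := fun {m} hm {a b} ha =>
    mem_of_reachable (A := {v | (.copy m v : JoinVertex q p R.V) ∈ A})
      (fun x hx y hxy => closed _ _ hx (join_adj_copy hxy) fun w e => hm (JoinVertex.copy.inj e).1)
      (h.connected.preconnected a b) ha
  have arm_ne : ∀ {m : Fin q} {t : ℕ}, m ≠ j → ∀ w, pathVertex R p m t ≠ .copy j w := by
    intro m t hm w e
    rcases t with _ | t
    · rw [pathVertex_zero] at e
      cases e
    · exact hm (pathVertex_succ_eq_copy e).1
  have up : ∀ n ≤ p k, pathVertex R p k (p k - n) ∈ A := by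
    intro n hn
    induction n with
    | zero =>
      rw [Nat.sub_zero, pathVertex_root k (hp k)]
      exact inCopy hkj hv
    | succ n ih =>
      refine closed _ _ (ih (by omega)) ?_ (arm_ne hkj)
      have := join_adj_pathVertex (p := p) h k (t := p k - (n + 1)) (by omega)
      rw [show p k - (n + 1) + 1 = p k - n by omega] at this
      exact this.symm
  have down : ∀ n ≤ p i, pathVertex R p i n ∈ A := by
    intro n hn
    induction n with
    | zero =>
      have := up (p k) le_rfl
      rwa [Nat.sub_self, pathVertex_zero] at this
    | succ n ih => exact closed _ _ (ih (by omega)) (join_adj_pathVertex h i (by omega)) (arm_ne hij)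
  have := down (p i) le_rfl
  rw [pathVertex_root i (hp i)] at this
  exact hu (inCopy hij this)

/-- Take three copies and order the times at which each has `k` boundary vertices. At the middle
time the first copy has already lost a vertex and the last still retains one. The connection between
them avoids the middle copy and yields one more boundary vertex. -/
theorem BoundaryAtLeast.join [Finite R.V] (h : IsLayering R d) (hp : ∀ j, 0 < p j) (hq : 3 ≤ q)
    {k : ℕ} (hk : 1 ≤ k) (hR : BoundaryAtLeast R.graph k) :
    BoundaryAtLeast (join R p).graph (k + 1) := by
  have : Finite (HuntersRabbit.join R p).V := inferInstanceAs (Finite (JoinVertex q p R.V))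
  intro A hA
  choose s hs using fun j => hR _ (hA.copy j)
  have key : ∀ i j l : Fin q, i ≠ j → l ≠ j → s i ≤ s j → s j ≤ s l →
      ∃ t, k + 1 ≤ (outerBoundary (HuntersRabbit.join R p).graph (A t)).ncard := by
    intro i j l hij hlj h1 h2
    have hne : ∀ m, (outerBoundary R.graph
        {v | (.copy m v : JoinVertex q p R.V) ∈ A (s m)}).Nonempty := fun m =>
      Set.nonempty_of_ncard_ne_zero (by have := hs m; omega)
    obtain ⟨u, hu, -⟩ := hne i
    obtain ⟨-, -, v, hv, -⟩ := hne l
    obtain ⟨x, hx, hxj⟩ := exists_outerBoundary_of_copies h hp hij hlj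
      (fun h' => hu (hA.antitone h1 h')) (hA.antitone h2 hv)
    refine ⟨s j, ?_⟩
    let f : R.V → (HuntersRabbit.join R p).V := fun v => .copy j v
    have hf : Function.Injective f := fun _ _ e => (JoinVertex.copy.inj e).2
    have hsub : insert x (f '' outerBoundary R.graph
        {v | (.copy j v : JoinVertex q p R.V) ∈ A (s j)}) ⊆
        outerBoundary (HuntersRabbit.join R p).graph (A (s j)) := by
      rintro _ (rfl | ⟨y, ⟨hy, z, hz, hyz⟩, rfl⟩)
      · exact hx
      · exact ⟨hy, f z, hz, join_adj_copy hyz⟩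
    refine le_trans ?_ (Set.ncard_le_ncard hsub (Set.toFinite _))
    rw [Set.ncard_insert_of_notMem, Set.ncard_image_of_injective _ hf]
    · exact Nat.succ_le_succ (hs j)
    · rintro ⟨w, -, e⟩
      exact hxj w e.symm
  let a : Fin q := ⟨0, by omega⟩
  let b : Fin q := ⟨1, by omega⟩
  let c : Fin q := ⟨2, by omega⟩
  have hab : a ≠ b := by simp [a, b]
  have hac : a ≠ c := by simp [a, c]
  have hbc : b ≠ c := by simp [b, c]
  rcases le_total (s a) (s b) with h1 | h1 <;> rcases le_total (s b) (s c) with h2 | h2 <;>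
    rcases le_total (s a) (s c) with h3 | h3
  · exact key a b c hab hbc.symm h1 h2
  · exact key a b c hab hbc.symm h1 h2
  · exact key a c b hac hbc h3 h2
  · exact key c a b hac.symm hab.symm h3 h1
  · exact key b a c hab.symm hac.symm h1 h3
  · exact key b c a hbc hac h2 h3
  · exact key c b a hbc.symm hab h2 h1
  · exact key c b a hbc.symm hab h2 h1

end Join

/-! ### From monotone strategies to clearings. -/

section Monotone

variable {V : Type*} {G : SimpleGraph V} {W : Set V} {S : HunterStrategy V}

theorem contaminated_subset (hb : IsBipartition G W Wᶜ) (t : ℕ) :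
    contaminated G W S t ⊆ {x | x ∈ W ↔ Even t} := by
  induction t with
  | zero => exact fun x hx => iff_of_true hx ⟨0, rfl⟩
  | succ t ih =>
    rintro x ⟨y, hy, -, hxy⟩
    have h1 : y ∈ W ↔ Even t := ih hy
    have h2 : ¬ (x ∈ W ∧ y ∈ W) := fun h => hb.2.1 h.1 h.2 hxy.ne hxy
    have h3 : ¬ (x ∉ W ∧ y ∉ W) := fun h => hb.2.2 h.1 h.2 hxy.ne hxy
    simp only [Set.mem_ofPred_eq, Nat.even_add_one]
    tauto

/-- If `v` is contaminated and unshot at some time, all its neighbours are contaminated at the next;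
so `v` can disappear two rounds later only if they are all shot. Hence the first loss of `v` in its
own parity is a clearing. -/
theorem exists_cleared_of_notMem (hb : IsBipartition G W Wᶜ) (hn : ∀ v, ∃ u, G.Adj v u) {v : V}
    (t : ℕ) (hv : v ∈ W ↔ Even t) (hvt : v ∉ contaminated G W S t) :
    ∃ i, 1 ≤ i ∧ i ≤ t ∧ Cleared G W S v i := by
  have last : ∀ t, (∀ u, G.Adj v u → u ∈ contaminated G W S t) →
      v ∉ contaminated G W S (t + 1) → Cleared G W S v (t + 1) := by
    intro t hu hvt
    obtain ⟨u, huv⟩ := hn v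
    refine .inr ⟨⟨u, huv, hu u huv⟩, ?_⟩
    rintro w ⟨hw, hwt⟩
    by_contra hwS
    exact hvt ⟨w, hwt, hwS, hw⟩
  induction t using Nat.twoStepInduction with
  | zero => exact absurd (hv.2 (by simp)) hvt
  | one =>
    refine ⟨1, le_rfl, le_rfl, last 0 (fun u hu => ?_) hvt⟩
    by_contra huW
    exact hb.2.2 (show v ∈ Wᶜ by simp [hv]) huW hu.ne hu
  | more t ih _ =>
    by_cases hvt' : v ∈ contaminated G W S t
    · by_cases hvS : v ∈ S.shot (t + 1)
      · exact ⟨t + 1, by omega, by omega, .inl hvS⟩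
      · exact ⟨t + 2, by omega, le_rfl, last (t + 1) (fun u hu => ⟨v, hvt', hvS, hu.symm⟩) hvt⟩
    · obtain ⟨i, h1, h2, h3⟩ := ih (by rw [hv, Nat.even_add_one, Nat.even_add_one, not_not]) hvt'
      exact ⟨i, h1, by omega, h3⟩

/-- The contaminated vertices that are not shot, preceded by both classes of the bipartition. -/
def survivors (G : SimpleGraph V) (W : Set V) (S : HunterStrategy V) : ℕ → Set V
  | 0 => W
  | 1 => Wᶜ
  | t + 2 => contaminated G W S t \ S.shot (t + 1)

theorem survivors_subset (hb : IsBipartition G W Wᶜ) (t : ℕ) :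
    survivors G W S t ⊆ {x | x ∈ W ↔ Even t} := by
  match t with
  | 0 => exact fun x hx => iff_of_true hx ⟨0, rfl⟩
  | 1 => exact fun x hx => iff_of_false hx (by decide)
  | t + 2 =>
    intro x hx
    have := contaminated_subset hb t hx.1
    simpa [Nat.even_add] using this

/-- This is where monotonicity enters: a contaminated vertex that is spared now was never cleared
before, so it was also contaminated and spared two rounds earlier. -/
theorem survivors_add_two_subset (hb : IsBipartition G W Wᶜ) (hn : ∀ v, ∃ u, G.Adj v u)
    (hw : Winning G W S) (hm : MonotoneStrategy G W S) (t : ℕ) :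
    survivors G W S (t + 2) ⊆ survivors G W S t := by
  rw [winning_iff_contaminated] at hw
  have hlt : ∀ {t v}, v ∈ contaminated G W S t → t < S.length := by
    intro t v hv
    by_contra hle
    rw [contaminated_eq_empty_of_le hw (not_lt.1 hle)] at hv
    exact hv
  match t with
  | 0 => exact fun x hx => (survivors_subset hb 2 hx).2 even_two
  | 1 => exact fun x hx h => absurd ((survivors_subset hb 3 hx).1 h) (by decide)
  | t + 2 =>
    rintro v ⟨hv, hvS⟩
    have hclear : ∀ i, 1 ≤ i → i < t + 2 → ¬ Cleared G W S v i := fun i h1 h2 hc =>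
      hvS (hm v i (t + 2) h1 h2 (hlt hv) hc hv)
    refine ⟨?_, fun h => hclear (t + 1) (by omega) (by omega) (.inl h)⟩
    by_contra hvt
    have hvW : v ∈ W ↔ Even t := by simpa [Nat.even_add] using contaminated_subset hb (t + 2) hv
    obtain ⟨i, h1, h2, h3⟩ := exists_cleared_of_notMem hb hn t hvW hvt
    exact hclear i h1 (by omega) h3

/-- The neighbours of surviving vertices that do not survive are shot. -/
theorem ncard_le_hunters (hb : IsBipartition G W Wᶜ) (hw : Winning G W S) (t : ℕ) :
    {x | x ∉ survivors G W S (t + 1) ∧ ∃ y ∈ survivors G W S t, G.Adj x y}.ncard ≤ S.hunters := by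
  rw [winning_iff_contaminated] at hw
  have main : ∀ t, (contaminated G W S t ∩ S.shot (t + 1)).ncard ≤ S.hunters := by
    intro t
    by_cases ht : t < S.length
    · calc (contaminated G W S t ∩ S.shot (t + 1)).ncard
          ≤ (S.shot (t + 1) : Set V).ncard :=
            Set.ncard_le_ncard Set.inter_subset_right (Finset.finite_toSet _)
        _ = (S.shot (t + 1)).card := Set.ncard_coe_finset _
        _ ≤ S.hunters :=
            Finset.le_sup (f := fun i => (S.shot i).card) (Finset.mem_Icc.2 ⟨by omega, ht⟩)
    · rw [contaminated_eq_empty_of_le hw (not_lt.1 ht)]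
      simp
  have fin : ∀ t, (contaminated G W S t ∩ S.shot (t + 1)).Finite := fun t =>
    (Finset.finite_toSet _).subset Set.inter_subset_right
  match t with
  | 0 =>
    have : {x | x ∉ survivors G W S 1 ∧ ∃ y ∈ survivors G W S 0, G.Adj x y} = ∅ := by
      refine Set.eq_empty_of_forall_notMem ?_
      rintro x ⟨hx, y, hy, hxy⟩
      exact hb.2.1 (not_not.1 hx) hy hxy.ne hxy
    simp [this]
  | 1 =>
    refine (Set.ncard_le_ncard ?_ (fin 0)).trans (main 0)
    rintro x ⟨hx, y, hy, hxy⟩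
    have hxW : x ∈ W := by
      by_contra hxW
      exact hb.2.2 hxW hy hxy.ne hxy
    exact ⟨hxW, by_contra fun h => hx ⟨hxW, h⟩⟩
  | t + 2 =>
    refine (Set.ncard_le_ncard ?_ (fin (t + 1))).trans (main (t + 1))
    rintro x ⟨hx, y, ⟨hy, hyS⟩, hxy⟩
    have hxc : x ∈ contaminated G W S (t + 1) := ⟨y, hy, hyS, hxy⟩
    exact ⟨hxc, by_contra fun h => hx ⟨hxc, h⟩⟩

/-- Each boundary vertex of the union of two consecutive survivor sets has a neighbour in one of
them and is missing from the next survivor set, so it was shot in one of two rounds. -/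
theorem BoundaryAtLeast.le_two_mul_hunters [Finite V] {k : ℕ} (hk : BoundaryAtLeast G k)
    (hb : IsBipartition G W Wᶜ) (hn : ∀ v, ∃ u, G.Adj v u)
    (hw : Winning G W S) (hm : MonotoneStrategy G W S) : k ≤ 2 * S.hunters := by
  have hsub := survivors_add_two_subset hb hn hw hm
  let A : ℕ → Set V := fun t => survivors G W S t ∪ survivors G W S (t + 1)
  have hA : IsClearing G A := by
    refine ⟨antitone_nat_of_succ_le fun t x hx => ?_, ?_, ⟨S.length + 2, ?_⟩, ?_⟩
    · rcases hx with hx | hx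
      exacts [.inr hx, .inl (hsub t hx)]
    · exact Set.union_compl_self W
    · have h0 := winning_iff_contaminated.1 hw
      have h1 := contaminated_eq_empty_of_le h0 (Nat.le_succ _)
      simp [A, survivors, h0, h1]
    -- Vertices lost at this step all lie in `survivors G W S t`, which is contained in one class of
    -- the bipartition and hence contains no edge.
    · intro x y t hxy hx hy
      by_contra! hcon
      have hx' : x ∈ survivors G W S t := hx.resolve_right fun h => hcon.1 (.inl h)
      have hy' : y ∈ survivors G W S t := hy.resolve_right fun h => hcon.2 (.inl h)
      have h1 : x ∈ W ↔ Even t := survivors_subset hb t hx'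
      have h2 : y ∈ W ↔ Even t := survivors_subset hb t hy'
      by_cases ht : Even t
      · exact hb.2.1 (h1.2 ht) (h2.2 ht) hxy.ne hxy
      · exact hb.2.2 (fun h => ht (h1.1 h)) (fun h => ht (h2.1 h)) hxy.ne hxy
  obtain ⟨t, ht⟩ := hk A hA
  have hle : outerBoundary G (A t) ⊆
      {x | x ∉ survivors G W S (t + 1) ∧ ∃ y ∈ survivors G W S t, G.Adj x y} ∪
      {x | x ∉ survivors G W S (t + 2) ∧ ∃ y ∈ survivors G W S (t + 1), G.Adj x y} := by
    rintro x ⟨hx, y, hy | hy, hxy⟩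
    · exact .inl ⟨fun h => hx (.inr h), y, hy, hxy⟩
    · exact .inr ⟨fun h => hx (.inl (hsub t h)), y, hy, hxy⟩
  calc k ≤ _ := ht
    _ ≤ _ := Set.ncard_le_ncard hle (Set.toFinite _)
    _ ≤ _ := Set.ncard_union_le _ _
    _ ≤ S.hunters + S.hunters :=
      add_le_add (ncard_le_hunters hb hw t) (ncard_le_hunters hb hw (t + 1))
    _ = 2 * S.hunters := (two_mul _).symm

end Monotone

/-! ### Strategies from lists, and playing twice. -/

section Strategies

/-- The hunter strategy that shoots the sets of a list in turn. -/
def HunterStrategy.ofList {V : Type*} (l : List (Finset V)) (hl : ∀ S ∈ l, S.Nonempty) :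
    HunterStrategy V where
  length := l.length
  shot i := l.getD (i - 1) ∅
  nonempty i h1 h2 := by
    have h : i - 1 < l.length := by omega
    rw [List.getD_eq_getElem l ∅ h]
    exact hl _ (List.getElem_mem h)

theorem HunterStrategy.hunters_ofList_le {V : Type*} {l : List (Finset V)}
    (hl : ∀ S ∈ l, S.Nonempty) {k : ℕ} (hk : ∀ S ∈ l, S.card ≤ k) :
    (ofList l hl).hunters ≤ k := by
  refine Finset.sup_le fun i hi => ?_
  rw [Finset.mem_Icc] at hi
  have h : i - 1 < l.length := by
    have : i ≤ l.length := hi.2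
    omega
  change (l.getD (i - 1) ∅).card ≤ k
  rw [List.getD_eq_getElem l ∅ h]
  exact hk _ (List.getElem_mem h)

/-- The strategy played twice. -/
def HunterStrategy.double {V : Type*} (S : HunterStrategy V) : HunterStrategy V where
  length := S.length + S.length
  shot i := if i ≤ S.length then S.shot i else S.shot (i - S.length)
  nonempty i h1 h2 := by
    split_ifs with h
    · exact S.nonempty i h1 h
    · exact S.nonempty _ (by omega) (by omega)

theorem HunterStrategy.hunters_double_le {V : Type*} (S : HunterStrategy V) :
    S.double.hunters ≤ S.hunters := by
  refine Finset.sup_le fun i hi => ?_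
  rw [Finset.mem_Icc] at hi
  have h : i ≤ S.length + S.length := hi.2
  change (if i ≤ S.length then S.shot i else S.shot (i - S.length)).card ≤ _
  split_ifs with h'
  · exact Finset.le_sup (f := fun i => (S.shot i).card) (Finset.mem_Icc.2 ⟨hi.1, h'⟩)
  · exact Finset.le_sup (f := fun i => (S.shot i).card) (Finset.mem_Icc.2 ⟨by omega, by omega⟩)

/-- A strategy of odd length that wins against a rabbit starting in a class of the bipartition wins
against any rabbit when it is played twice. -/
theorem Winning.double {V : Type*} {G : SimpleGraph V} {W : Set V} {S : HunterStrategy V}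
    (hb : IsBipartition G W Wᶜ) (hS : Winning G W S) (hodd : Odd S.length) :
    Winning G Set.univ S.double := by
  intro r _ hr
  have hr : ∀ i < S.length + S.length, G.Adj (r i) (r (i + 1)) := hr
  by_cases h0 : r 0 ∈ W
  · obtain ⟨j, hj, hjS⟩ := hS r h0 fun i hi => hr i (by omega)
    refine ⟨j, (by omega : j < S.length + S.length), ?_⟩
    change r j ∈ if j + 1 ≤ S.length then _ else _
    rwa [if_pos (by omega)]
  -- A rabbit starting outside `W` is in `W` when the second play begins, because the length is odd.
  · have hpar : ∀ i ≤ S.length, (r i ∈ W ↔ Odd i) := by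
      intro i hi
      induction i with
      | zero => simpa using h0
      | succ i ih =>
        have h1 := ih (by omega)
        have hadj := hr i (by omega)
        have h2 : ¬ (r i ∈ W ∧ r (i + 1) ∈ W) := fun h => hb.2.1 h.1 h.2 hadj.ne hadj
        have h3 : ¬ (r i ∉ W ∧ r (i + 1) ∉ W) := fun h => hb.2.2 h.1 h.2 hadj.ne hadj
        rw [Nat.odd_add_one]
        tauto
    obtain ⟨j, hj, hjS⟩ := hS (fun i => r (S.length + i)) ((hpar _ le_rfl).2 hodd)
      fun i hi => hr (S.length + i) (by omega)
    refine ⟨S.length + j, (by omega : S.length + j < S.length + S.length), ?_⟩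
    change r (S.length + j) ∈ if S.length + j + 1 ≤ S.length then _ else _
    rwa [if_neg (by omega), show S.length + j + 1 - S.length = j + 1 by omega]

theorem mem_exposedRun_of_walk {R : RootedGraph} (l : List (Finset R.V)) (t : ℕ) (Z : Set R.V)
    (r : ℕ → R.V) (h0 : r 0 ∈ Z) (h1 : ∀ i < l.length, R.graph.Adj (r i) (r (i + 1)))
    (h2 : ∀ i < l.length, r i ∉ l.getD i ∅) : r l.length ∈ exposedRun R t l Z := by
  induction l generalizing t Z r with
  | nil => exact h0
  | cons S l ih =>
    refine ih (t + 1) _ (fun i => r (i + 1)) (.inl ⟨r 0, h0, ?_, ?_⟩) (fun i hi => ?_)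
      fun i hi => ?_
    · simpa using h2 0 (by simp)
    · exact (h1 0 (by simp)).symm
    · exact h1 (i + 1) (by simpa using hi)
    · simpa using h2 (i + 1) (by simpa using hi)

theorem ExposedClearable.exists_winning {R : RootedGraph} {d : R.V → ℕ} {L : ℕ}
    (h : IsLayering R d) (hR : ExposedClearable R d L) :
    ∃ S : HunterStrategy R.V, Winning R.graph R.red S ∧ Odd S.length ∧ S.hunters ≤ 2 := by
  obtain ⟨l, h1, -, h3, h4⟩ := hR
  -- Only the root can remain contaminated; the extra shot removes it and turns the even length into
  -- an odd one.
  have hl : TwoHunterShots (l ++ [{R.root}]) := h1.append (by simp [TwoHunterShots])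
  refine ⟨.ofList (l ++ [{R.root}]) fun S hS => (hl S hS).1, ?_, ?_,
    HunterStrategy.hunters_ofList_le _ fun S hS => (hl S hS).2⟩
  · intro r h0 hadj
    have hlen : (l ++ [{R.root}]).length = l.length + 1 := by simp
    by_contra! hcon
    replace hadj : ∀ i < (l ++ [{R.root}]).length, R.graph.Adj (r i) (r (i + 1)) := hadj
    replace hcon : ∀ i < (l ++ [{R.root}]).length, r i ∉ (l ++ [{R.root}]).getD i ∅ := hcon
    rw [hlen] at hadj hcon
    rw [h.red_eq] at h0
    have := h4 _ (mem_exposedRun_of_walk l 0 _ r h0 (fun i hi => hadj i (by omega)) fun i hi => by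
      have := hcon i (by omega)
      rwa [List.getD_append _ _ _ _ hi] at this)
    have h' := hcon l.length (by omega)
    rw [List.getD_append_right _ _ _ _ le_rfl] at h'
    simp [this] at h'
  · change Odd (l ++ [{R.root}]).length
    rw [List.length_append]
    exact h3.add_one

end Strategies

/-! ### Link lengths and induction on the level of the gap trees. -/

section GapTree

theorem even_evenCeil (n : ℕ) : Even (evenCeil n) := by
  rw [evenCeil, Nat.even_iff]
  omega

theorem even_linkLength (l j : ℕ) : Even (linkLength l j) := by
  cases j <;> rw [linkLength]
  · exact even_two
  · exact even_evenCeil _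

theorem add_sum_linkLength_le (l : ℕ) {j : ℕ} (hj : 0 < j) :
    l + ∑ k ∈ Finset.range j, linkLength l k ≤ linkLength l j := by
  obtain ⟨j, rfl⟩ := Nat.exists_eq_add_of_lt hj
  rw [zero_add, linkLength.eq_2, Fin.sum_univ_eq_sum_range (linkLength l)]
  exact Nat.le_add_right _ _

theorem linkLength_pos (l j : ℕ) : 0 < linkLength l j := by
  rcases Nat.eq_zero_or_pos j with rfl | hj
  · simp [linkLength]
  · have h1 := add_sum_linkLength_le l hj
    have h2 : linkLength l 0 ≤ ∑ k ∈ Finset.range j, linkLength l k :=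
      Finset.single_le_sum (fun _ _ => Nat.zero_le _) (Finset.mem_range.2 hj)
    have h3 : linkLength l 0 = 2 := by simp [linkLength]
    omega

theorem add_sum_lt_linkLength_le (l : ℕ) {q : ℕ} {j k : Fin q} (hjk : j < k) :
    l + ∑ i with i < k, linkLength l (i : Fin q) ≤ linkLength l k := by
  refine le_trans (Nat.add_le_add_left ?_ _)
    (add_sum_linkLength_le l (Nat.zero_lt_of_lt (Fin.lt_def.1 hjk)))
  rw [← Finset.sum_image (f := linkLength l) (g := fun i : Fin q => (i : ℕ))
    (fun _ _ _ _ => Fin.ext)]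
  refine Finset.sum_le_sum_of_subset fun n hn => ?_
  simp only [Finset.mem_image, Finset.mem_filter, Finset.mem_univ, true_and] at hn
  obtain ⟨i, hi, rfl⟩ := hn
  exact Finset.mem_range.2 hi

theorem ExposedClearable.mono {R : RootedGraph} {d : R.V → ℕ} {L L' : ℕ}
    (h : ExposedClearable R d L) (hL : L ≤ L') : ExposedClearable R d L' := by
  obtain ⟨l, h1, h2, h3⟩ := h
  exact ⟨l, h1, h2.trans hL, h3⟩

theorem isSpider_spider {q : ℕ} (hq : 3 ≤ q) :
    ∃ c a b e, IsSpider (spider 3 q).graph c a b e ∧ Even (joinDepth (fun _ => 0) c) ∧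
      ∀ k : Fin 3, Even (joinDepth (R := point) (p := fun _ : Fin q => 3) (fun _ => 0) (b k)) := by
  let v : Fin 3 → ℕ → JoinVertex q (fun _ => 3) point.V := fun k t =>
    pathVertex point (fun _ => 3) ⟨k, by omega⟩ t
  have hd : ∀ k, ∀ t ≤ 3, joinDepth (fun _ => 0) (v k t) = t := fun k t ht =>
    joinDepth_pathVertex rfl _ ht
  have hadj : ∀ k, ∀ t < 3, (spider 3 q).graph.Adj (v k t) (v k (t + 1)) := fun k t ht =>
    join_adj_pathVertex isLayering_point _ ht
  have hinj : ∀ t, t ≠ 0 → Function.Injective fun k => v k t := by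
    intro t ht k k' e
    have := congrArg arm e
    simp only [v, arm_pathVertex _ ht, Option.some.injEq, Fin.mk.injEq] at this
    exact Fin.ext this
  have hne : ∀ k s t, s ≤ 3 → t ≤ 3 → s ≠ t → v k s ≠ v k t := fun k s t hs ht hst e =>
    hst (by rw [← hd k s hs, ← hd k t ht, e])
  refine ⟨.center, fun k => v k 1, fun k => v k 2, fun k => v k 3,
    ⟨hinj 1 one_ne_zero, hinj 2 two_ne_zero, fun k => hne k 1 3 (by omega) le_rfl (by omega),
      fun k => hne k 2 0 (by omega) (by omega) (by omega), fun k => hadj k 0 (by omega),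
      fun k => hadj k 1 (by omega), fun k => hadj k 2 (by omega)⟩, ⟨0, rfl⟩, fun k => ?_⟩
  rw [hd k 2 (by omega)]
  exact even_two

theorem IsSpider.copy {R : RootedGraph} {q : ℕ} {p : Fin q → ℕ} {c : R.V} {a b e : Fin 3 → R.V}
    (h : IsSpider R.graph c a b e) (j : Fin q) :
    IsSpider (join R p).graph (copyEmbedding j c) (copyEmbedding j ∘ a) (copyEmbedding j ∘ b)
      (copyEmbedding j ∘ e) where
  inj_a := (copyEmbedding j).injective.comp h.inj_a
  inj_b := (copyEmbedding j).injective.comp h.inj_b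
  ne_ae i := (copyEmbedding j).injective.ne (h.ne_ae i)
  ne_bc i := (copyEmbedding j).injective.ne (h.ne_bc i)
  adj_ca i := join_adj_copy (h.adj_ca i)
  adj_ab i := join_adj_copy (h.adj_ab i)
  adj_be i := join_adj_copy (h.adj_be i)

theorem gapTree_properties {q : ℕ} (hq : 3 ≤ q) (i : ℕ) :
    ∃ d, IsLayering (gapTree q (i + 1)) d ∧ Finite (gapTree q (i + 1)).V ∧
      ExposedClearable (gapTree q (i + 1)) d (roundBound q (i + 1)) ∧
      (∃ c a b e, IsSpider (gapTree q (i + 1)).graph c a b e ∧ Even (d c) ∧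
        ∀ k, Even (d (b k))) ∧
      BoundaryAtLeast (gapTree q (i + 1)).graph (i + 1) := by
  induction i with
  | zero =>
    have hlay : IsLayering (spider 3 q) (joinDepth fun _ => 0) :=
      isLayering_point.join fun _ => by norm_num
    have hfin : Finite (spider 3 q).V :=
      have : Finite point.V := inferInstanceAs (Finite Unit)
      inferInstanceAs (Finite (JoinVertex q _ point.V))
    obtain ⟨c, a, b, e, h⟩ := isSpider_spider hq
    exact ⟨_, hlay, hfin, exposedClearable_spider q, ⟨c, a, b, e, h⟩,
      @boundaryAtLeast_one _ _ hfin hlay.connected _ _ (h.1.adj_ca 0)⟩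
  | succ i ih =>
    obtain ⟨d, hlay, hfin, hclear, ⟨c, a, b, e, h, hc, hb⟩, hbd⟩ := ih
    have hp : ∀ j : Fin q, 0 < linkLength (roundBound q (i + 1)) j := fun j => linkLength_pos _ _
    have hev : ∀ j : Fin q, Even (linkLength (roundBound q (i + 1)) j) := fun j =>
      even_linkLength _ _
    refine ⟨joinDepth d, hlay.join hp, inferInstanceAs (Finite (JoinVertex q _ _)),
      (exposedClearable_join hlay hp hev (fun j k hjk => add_sum_lt_linkLength_le _ hjk)
        hclear).mono (Nat.le_add_right _ _), ?_, hbd.join hlay hp hq (by omega)⟩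
    -- A spider of the previous tree survives in the first copy; the even link length preserves
    -- depth parities.
    exact ⟨_, _, _, _, h.copy ⟨0, by omega⟩, (hev _).add hc, fun k => (hev _).add (hb k)⟩

end GapTree

/-! ### The hunter numbers of the gap trees. -/

theorem hunterNumberWrt_eq_two {V : Type*} {G : SimpleGraph V} {W : Set V} {c : V}
    {a b e : Fin 3 → V} (h : IsSpider G c a b e) (hc : c ∈ W) (hb : ∀ i, b i ∈ W)
    {S : HunterStrategy V} (hS : Winning G W S) (h2 : S.hunters ≤ 2) :
    hunterNumberWrt G W = 2 := by
  rw [hunterNumberWrt, if_neg fun hs => h.ne_bc 0 (hs.elim _ _)]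
  refine le_antisymm (le_trans (Nat.sInf_le ⟨S, hS, rfl⟩) h2) (le_csInf ⟨_, S, hS, rfl⟩ ?_)
  rintro _ ⟨S', hS', rfl⟩
  exact h.two_le_hunters hc hb hS'

/-- Shooting every vertex at once. This makes the set in the definition of `monotoneHunterNumberWrt`
non-empty; the infimum of an empty set would be `0`. -/
theorem exists_monotone_winning {V : Type*} [Finite V] [Nonempty V] (G : SimpleGraph V)
    (W : Set V) : ∃ S : HunterStrategy V, Winning G W S ∧ MonotoneStrategy G W S := by
  have := Fintype.ofFinite V
  refine ⟨⟨1, fun _ => Finset.univ, fun _ _ _ => Finset.univ_nonempty⟩,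
    fun r _ _ => ⟨0, one_pos, Finset.mem_univ _⟩, fun v _ _ _ _ _ _ _ => Finset.mem_univ _⟩

theorem le_monotoneHunterNumberWrt {V : Type*} [Finite V] [Nontrivial V] {G : SimpleGraph V}
    {W : Set V} (hG : G.Connected) (hb : IsBipartition G W Wᶜ) {k : ℕ}
    (hk : BoundaryAtLeast G (2 * k)) : k ≤ monotoneHunterNumberWrt G W := by
  rw [monotoneHunterNumberWrt, if_neg (not_subsingleton V)]
  obtain ⟨S, hS, hm⟩ := exists_monotone_winning G W
  refine le_csInf ⟨_, S, hS, hm, rfl⟩ ?_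
  rintro _ ⟨S', hS', hm', rfl⟩
  have := hk.le_two_mul_hunters hb hG.preconnected.exists_adj_of_nontrivial hS' hm'
  omega

theorem gapTree_hunterNumbers (i : ℕ) (hi : 3 ≤ i) :
    Finite (gapTree (2 * i) (2 * i)).V ∧ (gapTree (2 * i) (2 * i)).graph.IsTree ∧
    IsBipartition (gapTree (2 * i) (2 * i)).graph (gapTree (2 * i) (2 * i)).red
      (gapTree (2 * i) (2 * i)).redᶜ ∧
    hunterNumberWrt (gapTree (2 * i) (2 * i)).graph (gapTree (2 * i) (2 * i)).red = 2 ∧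
    hunterNumber (gapTree (2 * i) (2 * i)).graph = 2 ∧
    i ≤ monotoneHunterNumberWrt (gapTree (2 * i) (2 * i)).graph
      (gapTree (2 * i) (2 * i)).red := by
  obtain ⟨d, hlay, hfin, hclear, ⟨c, a, b, e, hs, hc, hb⟩, hbd⟩ :=
    gapTree_properties (q := 2 * i) (by omega) (2 * i - 1)
  rw [Nat.sub_add_cancel (by omega)] at hbd
  generalize hn : 2 * i - 1 + 1 = n at *
  obtain rfl : n = 2 * i := by omega
  obtain ⟨S, hS, hodd, h2⟩ := hclear.exists_winning hlay
  have : Nontrivial (gapTree (2 * i) (2 * i)).V := ⟨⟨_, _, hs.ne_bc 0⟩⟩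
  refine ⟨hfin, hlay.isTree, hlay.isBipartition,
    hunterNumberWrt_eq_two hs (by rw [hlay.red_eq]; exact hc)
      (fun k => by rw [hlay.red_eq]; exact hb k) hS h2,
    hunterNumberWrt_eq_two hs trivial (fun _ => trivial) (hS.double hlay.isBipartition hodd)
      (S.hunters_double_le.trans h2),
    le_monotoneHunterNumberWrt hlay.connected hlay.isBipartition hbd⟩

end HuntersRabbit

theorem mainTheorem9 :
    (∀ i : ℕ, 3 ≤ i →
      Finite (HuntersRabbit.gapTree (2 * i) (2 * i)).V ∧
      (HuntersRabbit.gapTree (2 * i) (2 * i)).graph.IsTree ∧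
      HuntersRabbit.IsBipartition (HuntersRabbit.gapTree (2 * i) (2 * i)).graph
        (HuntersRabbit.gapTree (2 * i) (2 * i)).red
        (HuntersRabbit.gapTree (2 * i) (2 * i)).redᶜ ∧
      HuntersRabbit.hunterNumberWrt (HuntersRabbit.gapTree (2 * i) (2 * i)).graph
        (HuntersRabbit.gapTree (2 * i) (2 * i)).red = 2 ∧
      HuntersRabbit.hunterNumber (HuntersRabbit.gapTree (2 * i) (2 * i)).graph = 2 ∧
      i ≤ HuntersRabbit.monotoneHunterNumberWrt (HuntersRabbit.gapTree (2 * i) (2 * i)).graph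
        (HuntersRabbit.gapTree (2 * i) (2 * i)).red) ∧
    (∀ m : ℕ, ∃ (V : Type) (T : SimpleGraph V) (Vr Vw : Set V),
      Finite V ∧ T.IsTree ∧ HuntersRabbit.IsBipartition T Vr Vw ∧
      HuntersRabbit.hunterNumber T + m ≤ HuntersRabbit.monotoneHunterNumberWrt T Vr) := by

  refine ⟨HuntersRabbit.gapTree_hunterNumbers, fun m => ?_⟩
  -- A gap of `m` needs only index `m + 2`; `m + 3` also meets the requirement `3 ≤ i`.
  obtain ⟨h1, h2, h3, -, h5, h6⟩ := HuntersRabbit.gapTree_hunterNumbers (m + 3) (by omega)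
  exact ⟨_, _, _, _, h1, h2, h3, by omega⟩
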